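/- Let $H=-\frac{d^2}{dx^2}+|x|$ be the self-adjoint operator on $L^2(\mathbb R)$ with domain $\{u\in L^2(\mathbb R): u\in C^1(\mathbb R),\ u' \text{ locally absolutely continuous},\ -u''+|x|u\in L^2(\mathbb R)\}$. Let $\lambda_1<\lambda_2<\cdots$ be its eigenvalues in increasing order and, for each $k\ge 1$, let $\varphi_k$ be an $L^2$-normalized eigenfunction of $H$ for $\lambda_k$. For $\alpha\ge\frac12$, $\varepsilon>0$ and $n\ge 1$ put $$J_\alpha^\varepsilon(\lambda_n)=\{k\ge 1: |\lambda_k-\lambda_n|<w_\alpha^\varepsilon(\lambda_n)\},\qquad w_\alpha^\varepsilon(\lambda)=\begin{cases}\varepsilon\lambda^{\alpha-\frac12}, & \tfrac12\le\alpha<1,\\ \varepsilon\lambda^{\frac12}(\log\lambda)^{-1}, & \alpha=1,\\ \varepsilon\lambda^{\frac12}, & \alpha>1.\end{cases}$$ Call a (Lebesgue) measurable set $S\subset\mathbb R$ $\alpha$-thin if there is a constant $C>0$ with $\limsup_{|x|\to\infty}|S\cap[x,x+1]|\cdot|x|^\alpha<C$, where $|\cdot|$ of a set denotes Lebesgue measure.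 **Proposition 3.1 (Ingham-type spectral inequality).** Let $\alpha\ge\frac12$ and let $E\subset\mathbb R$ be a measurable set whose complement $E^c$ is $\alpha$-thin. Then there exist $\varepsilon>0$ and $\delta>0$ such that for every $n\ge 1$ the set $J_\alpha^\varepsilon(\lambda_n)$ is finite and $$\int_E\Big|\sum_{k\in J_\alpha^\varepsilon(\lambda_n)}c_k\varphi_k(x)\Big|^2\,dx\ \ge\ \delta\sum_{k\in J_\alpha^\varepsilon(\lambda_n)}|c_k|^2\qquad\text{for all } \{c_k\}_{k\ge1}\in\ell^2(\mathbb C).$$ The constants $\varepsilon,\delta$ depend neither on $n$, nor on $\{c_k\}$, nor on the choice of the normalized eigenfunctions. -/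

import Mathlib

open MeasureTheory Filter

noncomputable section

namespace AnharmonicOscillator

/-- A set `S ⊆ ℝ` is `α`-thin if `limsup_{|x| → ∞} |S ∩ [x, x + 1]| * |x| ^ α < C` for some
constant `C > 0`. The upper limit is taken in `[0, ∞]`, so it always has its genuine value. -/
def IsAlphaThin (α : ℝ) (S : Set ℝ) : Prop :=
  ∃ C : ℝ, 0 < C ∧
    limsup (fun x : ℝ => volume (S ∩ Set.Icc x (x + 1)) * ENNReal.ofReal (|x| ^ α))
      (comap (fun x : ℝ => |x|) atTop) < ENNReal.ofReal C

/-- The differential expression `H u = - u'' + |x| u`. -/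
def H (u : ℝ → ℂ) (x : ℝ) : ℂ :=
  -deriv (deriv u) x + ((|x| : ℝ) : ℂ) * u x

/-- The domain of the self-adjoint realization of `H` on `L²(ℝ)`: the functions `u ∈ L²(ℝ)` such
that `u` is `C¹`, `u'` is locally absolutely continuous and `H u ∈ L²(ℝ)`. A function of this kind
is the continuous representative of its class; `u''` exists almost everywhere. (This is the maximal
domain; the expression is in the limit point case at `±∞`, so no boundary condition is needed.) -/
structure MemDomain (u : ℝ → ℂ) : Prop where
  memLp : MemLp u 2 volume
  differentiable : Differentiable ℝ u
  absolutelyContinuous : ∀ a b : ℝ, AbsolutelyContinuousOnInterval (deriv u) a b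
  memLp_H : MemLp (H u) 2 volume

/-- `u` is an eigenfunction of `H` for the number `μ`, with `L²`-norm equal to one. -/
structure IsNormalizedEigenfunction (μ : ℝ) (u : ℝ → ℂ) : Prop where
  memDomain : MemDomain u
  eigen : ∀ᵐ x : ℝ, H u x = (μ : ℂ) * u x
  norm_eq_one : ∫ x : ℝ, ‖u x‖ ^ 2 = 1

/-- `μ` is an eigenvalue of `H`: there is a `u ≠ 0` in the domain of `H` with `H u = μ u`. -/
def IsEigenvalue (μ : ℝ) : Prop :=
  ∃ u : ℝ → ℂ, MemDomain u ∧ u ≠ 0 ∧ ∀ᵐ x : ℝ, H u x = (μ : ℂ) * u x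

/-- The eigenvalues of `H` in increasing order, numbered from zero: the smallest one, and then
recursively the smallest one that is larger than the previous one. -/
def eigenvalueAux : ℕ → ℝ
  | 0 => sInf {μ : ℝ | IsEigenvalue μ}
  | m + 1 => sInf {μ : ℝ | IsEigenvalue μ ∧ eigenvalueAux m < μ}

/-- The eigenvalues `λ₁ < λ₂ < ⋯` of `H`. -/
def eigenvalue (k : ℕ+) : ℝ :=
  eigenvalueAux k.natPred

/-- `φ` is a choice of normalized eigenfunctions: `φ k` is a normalized eigenfunction of `H` for
`λ_k`, for every `k` such that `λ_k` is an eigenvalue of `H`. (In fact every `λ_k` is one, but the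
definition does not presuppose this, so that such a `φ` exists without any spectral theory.) -/
def IsEigenfunctionSystem (φ : ℕ+ → ℝ → ℂ) : Prop :=
  ∀ k : ℕ+, IsEigenvalue (eigenvalue k) → IsNormalizedEigenfunction (eigenvalue k) (φ k)

/-- The half-width of the spectral window around the number `lam`. -/
def windowWidth (α ε lam : ℝ) : ℝ :=
  if α < 1 then ε * lam ^ (α - 1 / 2)
  else if α = 1 then ε * lam ^ (1 / 2 : ℝ) * (Real.log lam)⁻¹
  else ε * lam ^ (1 / 2 : ℝ)

/-- The set `J_α^ε(lam)` of the indices `k` such that `|λ_k - lam|` is less than the half-width of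
the spectral window. -/
def J (α ε lam : ℝ) : Set ℕ+ :=
  {k : ℕ+ | |eigenvalue k - lam| < windowWidth α ε lam}

end AnharmonicOscillator

end

/-! Let u = Σ c_k φ_k over a spectral window around λ = λ_n of half-width w. Then u'' = (|x| - λ)u -
f with f = Σ c_k(λ_k - λ)φ_k, and orthonormality gives ‖f‖ ≤ w‖u‖. For large λ it suffices that such
an approximate eigenfunction carries at most half of its mass on the thin set; this is
`exists_resolvent_estimate`.

That estimate bounds |u|² pointwise by nearby L² masses of u and f, multiplies by the measure of the
thin set in a unit interval, and sums. Far from the origin (`sq_le_unit_window`) thinness makes the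
u-term small, and the f-term has weight |a|^(-α)/max(1, λ - |a|) = O(1/λ + λ^(-α)), which w² ≤ ε²
min(λ, λ^α) compensates. On a bounded core thinness says nothing, but at high frequency u cannot
concentrate there: `sq_le_long_window` bounds |u|² by 9/ℓ times the mass, with ℓ much larger than
the core.

Only finitely many λ_n lie below the resulting threshold. For each, a small ε leaves at most the
index n in the window, and an eigenfunction has positive mass on E because its zeros are isolated
and E is not null (`eventually_spectralInequality`).

The enumeration of the spectrum needs two more facts: reflected Airy functions give arbitrarily
large eigenvalues (`exists_isEigenvalue_gt`), and a trace argument gives finitely many below any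
level (`finite_isEigenvalue_le`). -/

namespace AnharmonicOscillator

/-! ### Cutoff and local bounds on the derivative. -/

/-- The quadratic cutoff function of the interval `[a - ℓ, a + 2ℓ]`. -/
noncomputable def cutoff (a ℓ x : ℝ) : ℝ := (x - (a - ℓ)) * (a + 2 * ℓ - x) / ℓ ^ 2

theorem continuous_cutoff (a ℓ : ℝ) : Continuous (cutoff a ℓ) := by
  unfold cutoff; fun_prop

theorem cutoff_sq_le {a ℓ x : ℝ} (hℓ : 0 < ℓ) (hx : x ∈ Set.Icc (a - ℓ) (a + 2 * ℓ)) :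
    cutoff a ℓ x ^ 2 ≤ 81 / 16 := by
  have h1 : 0 ≤ cutoff a ℓ x :=
    div_nonneg (mul_nonneg (by linarith [hx.1]) (by linarith [hx.2])) (by positivity)
  have h2 : cutoff a ℓ x ≤ 9 / 4 := by
    unfold cutoff
    rw [div_le_iff₀ (by positivity)]
    nlinarith [sq_nonneg (2 * (x - a) - ℓ)]
  nlinarith

theorem four_le_cutoff_sq {a ℓ x : ℝ} (hℓ : 0 < ℓ) (hx : x ∈ Set.Icc a (a + ℓ)) :
    4 ≤ cutoff a ℓ x ^ 2 := by
  have h2 : 2 ≤ cutoff a ℓ x := by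
    unfold cutoff
    rw [le_div_iff₀ (by positivity)]
    nlinarith [mul_nonneg (sub_nonneg.2 hx.1) (sub_nonneg.2 hx.2)]
  nlinarith

theorem continuous_of_hasDerivAt {u v : ℝ → ℝ} (hu : ∀ x, HasDerivAt u (v x) x) :
    Continuous u :=
  continuous_iff_continuousAt.2 fun x => (hu x).continuousAt

/-- Caccioppoli's inequality. -/
theorem caccioppoli {u v w : ℝ → ℝ} (hu : ∀ x, HasDerivAt u (v x) x)
    (hv : ∀ x, HasDerivAt v (w x) x) (hw : Continuous w) {a ℓ : ℝ} (hℓ : 0 < ℓ) :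
    ∫ x in (a - ℓ)..(a + 2 * ℓ), cutoff a ℓ x ^ 2 * (1 / 2 * v x ^ 2 + w x * u x) ≤
      18 / ℓ ^ 2 * ∫ x in (a - ℓ)..(a + 2 * ℓ), u x ^ 2 := by
  have cu := continuous_of_hasDerivAt hu
  have cv := continuous_of_hasDerivAt hv
  have cχ := continuous_cutoff a ℓ
  set η : ℝ → ℝ := fun x => (2 * a + ℓ - 2 * x) / ℓ ^ 2 with hη
  have hχη : ∀ x, HasDerivAt (cutoff a ℓ) (η x) x := fun x => by
    have := (((hasDerivAt_id x).sub_const (a - ℓ)).mul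
      ((hasDerivAt_id x).const_sub (a + 2 * ℓ))).div_const (ℓ ^ 2)
    convert! this using 1
    simp only [hη, id]; ring
  have cη : Continuous η := by fun_prop
  have hd : ∀ x, HasDerivAt (fun x => cutoff a ℓ x ^ 2 * (u x * v x))
      (2 * cutoff a ℓ x * η x * (u x * v x) + cutoff a ℓ x ^ 2 * (v x * v x + u x * w x)) x :=
    fun x => by
    convert! ((hχη x).pow 2).mul ((hu x).mul (hv x)) using 1
    simp only [Pi.mul_apply, Pi.pow_apply]
    push_cast; ring
  -- The cutoff kills the boundary terms. Adding this zero to the right-hand side reduces the claim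
  -- to a pointwise one, which follows from (χv + 2ηu)² ≥ 0 and |η| ≤ 3/ℓ.
  have h0 : ∫ x in (a - ℓ)..(a + 2 * ℓ), (2 * cutoff a ℓ x * η x * (u x * v x) +
      cutoff a ℓ x ^ 2 * (v x * v x + u x * w x)) = 0 := by
    rw [intervalIntegral.integral_eq_sub_of_hasDerivAt (fun x _ => hd x)
      (Continuous.intervalIntegrable (by fun_prop) _ _)]
    simp [cutoff]
  rw [← add_zero (18 / ℓ ^ 2 * _), ← h0, ← intervalIntegral.integral_const_mul,
    ← intervalIntegral.integral_add
    (Continuous.intervalIntegrable (by fun_prop) _ _)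
    (Continuous.intervalIntegrable (by fun_prop) _ _)]
  refine intervalIntegral.integral_mono_on (by linarith)
    (Continuous.intervalIntegrable (by fun_prop) _ _)
    (Continuous.intervalIntegrable (by fun_prop) _ _) fun x hx => ?_
  have h9 : η x ^ 2 ≤ 9 / ℓ ^ 2 := by
    simp only [hη]
    rw [div_pow, div_le_div_iff₀ (by positivity) (by positivity)]
    have : (2 * a + ℓ - 2 * x) ^ 2 ≤ (3 * ℓ) ^ 2 := by
      apply sq_le_sq'
      · linarith [hx.2]
      · linarith [hx.1]
    nlinarith [sq_nonneg ℓ]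
  have h18 : 18 / ℓ ^ 2 = 2 * (9 / ℓ ^ 2) := by ring
  rw [h18]
  nlinarith [sq_nonneg (cutoff a ℓ x * v x + 2 * η x * u x),
    mul_nonneg (sub_nonneg.2 h9) (sq_nonneg (u x))]

/-- Caccioppoli with 4 ≤ χ² on the inner interval and χ² ≤ 81/16 on the outer one; halving gives
9/ℓ² and 81/32 ≤ 3. The majorant h lets each caller discard the favourable sign of the potential. -/
theorem integral_deriv_sq_le {u v w h : ℝ → ℝ} (hu : ∀ x, HasDerivAt u (v x) x)
    (hv : ∀ x, HasDerivAt v (w x) x) (hw : Continuous w) (hh : Continuous h)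
    {a ℓ : ℝ} (hℓ : 0 < ℓ) (h0 : ∀ x, 0 ≤ h x)
    (hle : ∀ x ∈ Set.Icc (a - ℓ) (a + 2 * ℓ), -(w x * u x) ≤ h x) :
    ∫ x in a..(a + ℓ), v x ^ 2 ≤ 3 * (∫ x in (a - ℓ)..(a + 2 * ℓ), h x) +
      9 / ℓ ^ 2 * ∫ x in (a - ℓ)..(a + 2 * ℓ), u x ^ 2 := by
  have cu := continuous_of_hasDerivAt hu
  have cv := continuous_of_hasDerivAt hv
  have cχ := continuous_cutoff a ℓ
  have key := caccioppoli hu hv hw (a := a) hℓ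
  have h1 : 2 * (∫ x in a..(a + ℓ), v x ^ 2) ≤
      ∫ x in (a - ℓ)..(a + 2 * ℓ), 1 / 2 * (cutoff a ℓ x ^ 2 * v x ^ 2) := by
    rw [← intervalIntegral.integral_const_mul]
    refine (intervalIntegral.integral_mono_on (g := fun x => 1 / 2 * (cutoff a ℓ x ^ 2 * v x ^ 2))
      (by linarith) (Continuous.intervalIntegrable (by fun_prop) _ _)
      (Continuous.intervalIntegrable (by fun_prop) _ _) fun x hx => ?_).trans ?_
    · nlinarith [mul_nonneg (sub_nonneg.2 (four_le_cutoff_sq hℓ hx)) (sq_nonneg (v x))]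
    · exact intervalIntegral.integral_mono_interval (by linarith) (by linarith) (by linarith)
        (ae_of_all _ fun x => by positivity) (Continuous.intervalIntegrable (by fun_prop) _ _)
  have h2 : ∫ x in (a - ℓ)..(a + 2 * ℓ), 1 / 2 * (cutoff a ℓ x ^ 2 * v x ^ 2) ≤
      (∫ x in (a - ℓ)..(a + 2 * ℓ), cutoff a ℓ x ^ 2 * (1 / 2 * v x ^ 2 + w x * u x)) +
      81 / 16 * ∫ x in (a - ℓ)..(a + 2 * ℓ), h x := by
    rw [← intervalIntegral.integral_const_mul, ← intervalIntegral.integral_add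
      (Continuous.intervalIntegrable (by fun_prop) _ _)
      (Continuous.intervalIntegrable (by fun_prop) _ _)]
    refine intervalIntegral.integral_mono_on (by linarith)
      (Continuous.intervalIntegrable (by fun_prop) _ _)
      (Continuous.intervalIntegrable (by fun_prop) _ _) fun x hx => ?_
    nlinarith [mul_nonneg (sub_nonneg.2 (cutoff_sq_le hℓ hx)) (h0 x), hle x hx,
      mul_le_mul_of_nonneg_left (hle x hx) (sq_nonneg (cutoff a ℓ x))]
  have h3 : 0 ≤ ∫ x in (a - ℓ)..(a + 2 * ℓ), h x :=
    intervalIntegral.integral_nonneg (by linarith) fun x _ => h0 x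
  have h18 : 18 / ℓ ^ 2 = 2 * (9 / ℓ ^ 2) := by ring
  rw [h18] at key
  linarith

/-! ### Pointwise bounds by local L² norms. -/

/-- If the increments of `F` between points of `[a, a + ℓ]` are at most `K`, then `F` is at most
its mean plus `K`. -/
theorem mul_le_integral_add {F : ℝ → ℝ} (cF : Continuous F) {a ℓ K y : ℝ} (hℓ : 0 < ℓ)
    (h : ∀ x ∈ Set.Icc a (a + ℓ), F y ≤ F x + K) :
    ℓ * F y ≤ (∫ x in a..(a + ℓ), F x) + ℓ * K := by
  have := intervalIntegral.integral_mono_on (f := fun _ => F y) (g := fun x => F x + K)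
    (μ := volume) (by linarith : a ≤ a + ℓ) (Continuous.intervalIntegrable (by fun_prop) _ _)
    (Continuous.intervalIntegrable (by fun_prop) _ _) h
  rw [intervalIntegral.integral_add (Continuous.intervalIntegrable (by fun_prop) _ _)
    (Continuous.intervalIntegrable (by fun_prop) _ _)] at this
  simpa using this

theorem sub_le_integral_of_abs_deriv_le {F F' G : ℝ → ℝ} (hF : ∀ x, HasDerivAt F (F' x) x)
    (cF' : Continuous F') (cG : Continuous G) {a b x y : ℝ}
    (hx : x ∈ Set.Icc a b) (hy : y ∈ Set.Icc a b) (h : ∀ t ∈ Set.Icc a b, |F' t| ≤ G t) :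
    F y ≤ F x + ∫ t in a..b, G t := by
  have h1 : F y - F x = ∫ t in x..y, F' t :=
    (intervalIntegral.integral_eq_sub_of_hasDerivAt (fun t _ => hF t)
      (cF'.intervalIntegrable _ _)).symm
  have hab : a ≤ b := hx.1.trans hx.2
  have h2 : |∫ t in x..y, F' t| ≤ ∫ t in a..b, |F' t| := by
    refine (intervalIntegral.norm_integral_le_abs_integral_norm).trans
      ((intervalIntegral.abs_integral_mono_interval
        (Set.uIoc_subset_uIoc_of_uIcc_subset_uIcc (Set.uIcc_subset_uIcc
          (by rwa [Set.uIcc_of_le hab]) (by rwa [Set.uIcc_of_le hab])))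
        (ae_of_all _ fun t => norm_nonneg _) (cF'.norm.intervalIntegrable _ _)).trans_eq ?_)
    exact abs_of_nonneg (intervalIntegral.integral_nonneg hab fun t _ => abs_nonneg _)
  have h3 : ∫ t in a..b, |F' t| ≤ ∫ t in a..b, G t :=
    intervalIntegral.integral_mono_on hab (cF'.abs.intervalIntegrable _ _)
      (cG.intervalIntegrable _ _) h
  linarith [le_abs_self (∫ t in x..y, F' t)]

/-- Energy estimate for `u'' = -D u + g`. -/
theorem energy_sup_le {u v g : ℝ → ℝ} {D : ℝ} (hu : ∀ x, HasDerivAt u (v x) x)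
    (hv : ∀ x, HasDerivAt v (-D * u x + g x) x) (hg : Continuous g)
    {a ℓ y : ℝ} (hℓ : 0 < ℓ) (hy : y ∈ Set.Icc a (a + ℓ)) :
    ℓ * (D * u y ^ 2) ≤ 2 * (∫ x in a..(a + ℓ), v x ^ 2) + D * (∫ x in a..(a + ℓ), u x ^ 2) +
      ℓ ^ 2 * ∫ x in a..(a + ℓ), g x ^ 2 := by
  have cu := continuous_of_hasDerivAt hu
  have cv := continuous_of_hasDerivAt hv
  -- The terms ±2Duv cancel: the energy changes only through the forcing g.
  have hd : ∀ x, HasDerivAt (fun x => v x ^ 2 + D * u x ^ 2) (2 * v x * g x) x := fun x => by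
    convert! ((hv x).pow 2).add (((hu x).pow 2).const_mul D) using 1
    push_cast; ring
  have h1 := mul_le_integral_add (F := fun x => v x ^ 2 + D * u x ^ 2) (y := y)
    (K := ∫ t in a..(a + ℓ), (1 / ℓ * v t ^ 2 + ℓ * g t ^ 2)) (by fun_prop) hℓ fun x hx =>
      sub_le_integral_of_abs_deriv_le hd (by fun_prop) (by fun_prop) hx hy fun t _ => by
        have h2 : 1 / ℓ * v t ^ 2 + ℓ * g t ^ 2 - 2 * v t * g t = (v t - ℓ * g t) ^ 2 / ℓ := by
          field_simp; ring
        have h3 : 1 / ℓ * v t ^ 2 + ℓ * g t ^ 2 + 2 * v t * g t = (v t + ℓ * g t) ^ 2 / ℓ := by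
          field_simp; ring
        have h4 : 0 ≤ (v t - ℓ * g t) ^ 2 / ℓ := by positivity
        have h5 : 0 ≤ (v t + ℓ * g t) ^ 2 / ℓ := by positivity
        rw [abs_le]
        constructor <;> linarith
  rw [intervalIntegral.integral_add (Continuous.intervalIntegrable (by fun_prop) _ _)
    (Continuous.intervalIntegrable (by fun_prop) _ _),
    intervalIntegral.integral_add (Continuous.intervalIntegrable (by fun_prop) _ _)
    (Continuous.intervalIntegrable (by fun_prop) _ _), intervalIntegral.integral_const_mul,
    intervalIntegral.integral_const_mul, intervalIntegral.integral_const_mul] at h1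
  have h6 : ℓ * (1 / ℓ * (∫ x in a..(a + ℓ), v x ^ 2) + ℓ * ∫ x in a..(a + ℓ), g x ^ 2) =
      (∫ x in a..(a + ℓ), v x ^ 2) + ℓ ^ 2 * ∫ x in a..(a + ℓ), g x ^ 2 := by
    field_simp
  nlinarith [mul_nonneg hℓ.le (sq_nonneg (v y))]

theorem integral_sq_add_sq_le {u f h : ℝ → ℝ} (cu : Continuous u) (cf : Continuous f)
    (ch : Continuous h) {a b a' b' A B : ℝ} (ha : a' ≤ a) (hab : a ≤ b) (hb : b ≤ b')
    (hA : 0 ≤ A) (hB : 0 ≤ B)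
    (hle : ∀ x ∈ Set.Icc a b, h x ≤ A * u x ^ 2 + B * f x ^ 2) :
    ∫ x in a..b, h x ≤ A * (∫ x in a'..b', u x ^ 2) + B * ∫ x in a'..b', f x ^ 2 := by
  rw [← intervalIntegral.integral_const_mul, ← intervalIntegral.integral_const_mul,
    ← intervalIntegral.integral_add (Continuous.intervalIntegrable (by fun_prop) _ _)
    (Continuous.intervalIntegrable (by fun_prop) _ _)]
  refine (intervalIntegral.integral_mono_on hab (ch.intervalIntegrable _ _)
    (Continuous.intervalIntegrable (by fun_prop) _ _) hle).trans ?_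
  exact intervalIntegral.integral_mono_interval ha hab hb
    (ae_of_all _ fun x => by positivity) (Continuous.intervalIntegrable (by fun_prop) _ _)

/-- Sup bound on a window where the potential `|x| - lam` is close to the constant `-D`. -/
theorem sq_le_of_oscillatory {u v f : ℝ → ℝ} {lam D B : ℝ} (hu : ∀ x, HasDerivAt u (v x) x)
    (hv : ∀ x, HasDerivAt v ((|x| - lam) * u x - f x) x) (hf : Continuous f)
    {a ℓ y : ℝ} (hℓ : 0 < ℓ) (hy : y ∈ Set.Icc a (a + ℓ)) (hD : 0 < D)
    (hB : ∀ x ∈ Set.Icc (a - ℓ) (a + 2 * ℓ), |(|x| - lam + D)| ≤ B) :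
    ℓ * D * u y ^ 2 ≤
      (7 * D + 6 * B ^ 2 + 3 + 18 / ℓ ^ 2 + 2 * ℓ ^ 2 * B ^ 2) *
        (∫ x in (a - ℓ)..(a + 2 * ℓ), u x ^ 2) +
      (6 + 2 * ℓ ^ 2) * ∫ x in (a - ℓ)..(a + 2 * ℓ), f x ^ 2 := by
  have cu := continuous_of_hasDerivAt hu
  have cv := continuous_of_hasDerivAt hv
  set g : ℝ → ℝ := fun x => (|x| - lam + D) * u x - f x with hg
  have cg : Continuous g := by fun_prop
  have hgle : ∀ x ∈ Set.Icc (a - ℓ) (a + 2 * ℓ), g x ^ 2 ≤ 2 * B ^ 2 * u x ^ 2 + 2 * f x ^ 2 := by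
    intro x hx
    have h1 : (|x| - lam + D) ^ 2 ≤ B ^ 2 := sq_le_sq' (abs_le.1 (hB x hx)).1 (abs_le.1 (hB x hx)).2
    simp only [hg]
    nlinarith [sq_nonneg ((|x| - lam + D) * u x + f x),
      mul_nonneg (sub_nonneg.2 h1) (sq_nonneg (u x))]
  -- The deviation of the potential from -D is moved into the forcing g, so the energy argument
  -- applies with constant frequency; `e2` then removes the derivative.
  have e1 := energy_sup_le (D := D) hu (fun x => by convert! hv x using 1; simp only [hg]; ring)
    cg hℓ hy
  have e2 := integral_deriv_sq_le (h := fun x => (D + 1 / 2) * u x ^ 2 + 1 / 2 * g x ^ 2) hu hv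
    (by fun_prop) (by fun_prop) (a := a) hℓ (fun x => by positivity) fun x _ => by
      simp only [hg]
      nlinarith [sq_nonneg ((|x| - lam + D) * u x - f x + u x)]
  have e3 := integral_sq_add_sq_le (h := fun x => (D + 1 / 2) * u x ^ 2 + 1 / 2 * g x ^ 2)
    (A := D + 1 / 2 + B ^ 2) (B := 1) cu hf (by fun_prop) le_rfl
    (by linarith : a - ℓ ≤ a + 2 * ℓ) le_rfl (by positivity) zero_le_one fun x hx => by
      linarith [hgle x hx]
  have e4 := integral_sq_add_sq_le (h := fun x => g x ^ 2)
    (A := 2 * B ^ 2) (B := 2) cu hf (by fun_prop) (by linarith : a - ℓ ≤ a)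
    (by linarith : a ≤ a + ℓ) (by linarith : a + ℓ ≤ a + 2 * ℓ) (by positivity) zero_le_two
    fun x hx => hgle x ⟨by linarith [hx.1], by linarith [hx.2]⟩
  have e5 := integral_sq_add_sq_le (h := fun x => u x ^ 2)
    (A := 1) (B := 0) cu hf (by fun_prop) (by linarith : a - ℓ ≤ a)
    (by linarith : a ≤ a + ℓ) (by linarith : a + ℓ ≤ a + 2 * ℓ) zero_le_one le_rfl
    fun x hx => by linarith
  have h18 : 18 / ℓ ^ 2 = 2 * (9 / ℓ ^ 2) := by ring
  rw [h18]
  nlinarith [mul_le_mul_of_nonneg_left e4 (sq_nonneg ℓ), mul_le_mul_of_nonneg_left e5 hD.le]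

/-- Sup bound on a window where the potential `|x| - lam` is at least `-3`. -/
theorem sq_le_of_forbidden {u v f : ℝ → ℝ} {lam : ℝ} (hu : ∀ x, HasDerivAt u (v x) x)
    (hv : ∀ x, HasDerivAt v ((|x| - lam) * u x - f x) x) (hf : Continuous f)
    {a y : ℝ} (hy : y ∈ Set.Icc a (a + 1))
    (hB : ∀ x ∈ Set.Icc (a - 1) (a + 2), -3 ≤ |x| - lam) :
    u y ^ 2 ≤ 22 * (∫ x in (a - 1)..(a + 2), u x ^ 2) + 2 * ∫ x in (a - 1)..(a + 2), f x ^ 2 := by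
  have cu := continuous_of_hasDerivAt hu
  have cv := continuous_of_hasDerivAt hv
  have e2 := integral_deriv_sq_le (h := fun x => 7 / 2 * u x ^ 2 + 1 / 2 * f x ^ 2) hu hv
    (by fun_prop) (by fun_prop) (a := a) one_pos (fun x => by positivity) fun x hx => by
      have := hB x (by simpa using hx)
      nlinarith [sq_nonneg (f x - u x), mul_nonneg (sub_nonneg.2 this) (sq_nonneg (u x))]
  simp only [mul_one, one_pow, div_one] at e2
  have e3 := integral_sq_add_sq_le (h := fun x => 7 / 2 * u x ^ 2 + 1 / 2 * f x ^ 2)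
    (A := 7 / 2) (B := 1 / 2) cu hf (by fun_prop) le_rfl
    (by linarith : a - 1 ≤ a + 2) le_rfl (by positivity) (by positivity) fun x hx => le_rfl
  have e5 := integral_sq_add_sq_le (h := fun x => u x ^ 2)
    (A := 1) (B := 0) cu hf (by fun_prop) (by linarith : a - 1 ≤ a)
    (by linarith : a ≤ a + 1) (by linarith : a + 1 ≤ a + 2) zero_le_one le_rfl
    fun x hx => by linarith
  have hd : ∀ x, HasDerivAt (fun x => u x ^ 2) (2 * u x * v x) x := fun x => by
    convert! (hu x).pow 2 using 1
    push_cast; ring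
  have h1 := mul_le_integral_add (F := fun x => u x ^ 2) (y := y)
    (K := ∫ t in a..(a + 1), (u t ^ 2 + v t ^ 2)) (by fun_prop) one_pos fun x hx =>
      sub_le_integral_of_abs_deriv_le hd (by fun_prop) (by fun_prop) hx hy fun t _ => by
        rw [abs_le]
        constructor <;> nlinarith [sq_nonneg (u t - v t), sq_nonneg (u t + v t)]
  rw [intervalIntegral.integral_add (Continuous.intervalIntegrable (by fun_prop) _ _)
    (Continuous.intervalIntegrable (by fun_prop) _ _)] at h1
  have e6 : 0 ≤ ∫ x in (a - 1)..(a + 2), f x ^ 2 :=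
    intervalIntegral.integral_nonneg (by linarith) fun x _ => sq_nonneg _
  have e7 : 0 ≤ ∫ x in (a - 1)..(a + 2), u x ^ 2 :=
    intervalIntegral.integral_nonneg (by linarith) fun x _ => sq_nonneg _
  linarith

/-- Sup bound on unit windows. -/
theorem sq_le_unit_window {u v f : ℝ → ℝ} {lam : ℝ} (hu : ∀ x, HasDerivAt u (v x) x)
    (hv : ∀ x, HasDerivAt v ((|x| - lam) * u x - f x) x) (hf : Continuous f)
    {a y : ℝ} (hy : y ∈ Set.Icc a (a + 1)) :
    u y ^ 2 ≤ 60 * (∫ x in (a - 1)..(a + 2), u x ^ 2) +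
      8 / max 1 (lam - |a|) * ∫ x in (a - 1)..(a + 2), f x ^ 2 := by
  have e6 : 0 ≤ ∫ x in (a - 1)..(a + 2), f x ^ 2 :=
    intervalIntegral.integral_nonneg (by linarith) fun x _ => sq_nonneg _
  have e7 : 0 ≤ ∫ x in (a - 1)..(a + 2), u x ^ 2 :=
    intervalIntegral.integral_nonneg (by linarith) fun x _ => sq_nonneg _
  have habs : ∀ x ∈ Set.Icc (a - 1) (a + 2), |(|x| - |a|)| ≤ 2 := fun x hx =>
    (abs_abs_sub_abs_le_abs_sub x a).trans (abs_le.2 ⟨by linarith [hx.1], by linarith [hx.2]⟩)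
  -- If lam - |a| ≤ 1, the potential is at least -3 on the enlarged window. Otherwise it is within 2
  -- of -D with D ≥ 1, and 7D + 53 ≤ 60D; division by D produces the gain in the f-term.
  rcases le_total (lam - |a|) 1 with h | h
  · rw [max_eq_left h]
    have := sq_le_of_forbidden hu hv hf hy fun x hx => by linarith [(abs_le.1 (habs x hx)).1]
    linarith
  · rw [max_eq_right h]
    set D := lam - |a| with hD
    have hD0 : 0 < D := by linarith
    have := sq_le_of_oscillatory (D := D) (B := 2) hu hv hf one_pos hy hD0
      fun x hx => by
        have := habs x (by simpa using hx)
        rwa [show |x| - lam + D = |x| - |a| by rw [hD]; ring]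
    norm_num at this
    rw [div_mul_eq_mul_div, ← sub_nonneg]
    have h2 : 0 ≤ (60 * D * (∫ x in (a - 1)..(a + 2), u x ^ 2) +
      8 * (∫ x in (a - 1)..(a + 2), f x ^ 2) - D * u y ^ 2) / D := by
      apply div_nonneg _ hD0.le
      nlinarith
    convert h2 using 1
    field_simp

/-- Sup bound on a long window around the origin, for large frequencies. -/
theorem sq_le_long_window {u v f : ℝ → ℝ} {lam : ℝ} (hu : ∀ x, HasDerivAt u (v x) x)
    (hv : ∀ x, HasDerivAt v ((|x| - lam) * u x - f x) x) (hf : Continuous f)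
    {ℓ y : ℝ} (hℓ : 1 ≤ ℓ) (hlam : 100 * ℓ ^ 4 ≤ lam) (hy : |y| ≤ ℓ / 2) :
    u y ^ 2 ≤ 9 / ℓ * (∫ x in (-(3 / 2 * ℓ))..(3 / 2 * ℓ), u x ^ 2) +
      8 * ℓ / lam * ∫ x in (-(3 / 2 * ℓ))..(3 / 2 * ℓ), f x ^ 2 := by
  have e6 : 0 ≤ ∫ x in (-(3 / 2 * ℓ))..(3 / 2 * ℓ), f x ^ 2 :=
    intervalIntegral.integral_nonneg (by linarith) fun x _ => sq_nonneg _
  have e7 : 0 ≤ ∫ x in (-(3 / 2 * ℓ))..(3 / 2 * ℓ), u x ^ 2 :=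
    intervalIntegral.integral_nonneg (by linarith) fun x _ => sq_nonneg _
  have hℓ0 : 0 < ℓ := by linarith
  have hl2 : 1 ≤ ℓ ^ 2 := one_le_pow₀ hℓ
  have hl4 : ℓ ^ 2 ≤ ℓ ^ 4 := pow_le_pow_right₀ hℓ (by norm_num)
  have hlam0 : 0 < lam := by nlinarith
  -- Here |x| itself is the perturbation, at most 3ℓ/2. Its contribution is of order ℓ⁴, which is
  -- why lam has to dominate ℓ⁴.
  have := sq_le_of_oscillatory (a := -(ℓ / 2)) (D := lam) (B := 3 / 2 * ℓ) hu hv hf hℓ0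
    ⟨(abs_le.1 hy).1, by linarith [(abs_le.1 hy).2]⟩ hlam0 fun x hx => by
      rw [sub_add_cancel, abs_abs, abs_le]
      exact ⟨by linarith [hx.1], by linarith [hx.2]⟩
  rw [show -(ℓ / 2) - ℓ = -(3 / 2 * ℓ) by ring, show -(ℓ / 2) + 2 * ℓ = 3 / 2 * ℓ by ring] at this
  have h18 : 18 / ℓ ^ 2 ≤ 18 := div_le_self (by norm_num) hl2
  have h1 : 7 * lam + 6 * (3 / 2 * ℓ) ^ 2 + 3 + 18 / ℓ ^ 2 + 2 * ℓ ^ 2 * (3 / 2 * ℓ) ^ 2 ≤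
      9 * lam := by nlinarith
  have h2 : 6 + 2 * ℓ ^ 2 ≤ 8 * ℓ ^ 2 := by linarith
  have h3 : ℓ * lam * u y ^ 2 ≤ 9 * lam * (∫ x in (-(3 / 2 * ℓ))..(3 / 2 * ℓ), u x ^ 2) +
      8 * ℓ ^ 2 * ∫ x in (-(3 / 2 * ℓ))..(3 / 2 * ℓ), f x ^ 2 :=
    this.trans (add_le_add (mul_le_mul_of_nonneg_right h1 e7) (mul_le_mul_of_nonneg_right h2 e6))
  rw [← sub_nonneg]
  have h4 := div_nonneg (sub_nonneg.2 h3) (by positivity : 0 ≤ ℓ * lam)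
  refine h4.trans_eq ?_
  field_simp

/-! ### Complex-valued solutions. -/

theorem hasDerivAt_re {u : ℝ → ℂ} {v : ℂ} {x : ℝ} (h : HasDerivAt u v x) :
    HasDerivAt (fun t => (u t).re) v.re x :=
  Complex.reCLM.hasFDerivAt.comp_hasDerivAt x h

theorem hasDerivAt_im {u : ℝ → ℂ} {v : ℂ} {x : ℝ} (h : HasDerivAt u v x) :
    HasDerivAt (fun t => (u t).im) v.im x :=
  Complex.imCLM.hasFDerivAt.comp_hasDerivAt x h

theorem hasDerivAt_conj {u : ℝ → ℂ} {v : ℂ} {x : ℝ} (h : HasDerivAt u v x) :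
    HasDerivAt (fun t => (starRingEnd ℂ) (u t)) ((starRingEnd ℂ) v) x :=
  (Complex.conjCLE : ℂ →L[ℝ] ℂ).hasFDerivAt.comp_hasDerivAt x h

theorem continuous_of_hasDerivAt_complex {u v : ℝ → ℂ} (hu : ∀ x, HasDerivAt u (v x) x) :
    Continuous u :=
  continuous_iff_continuousAt.2 fun x => (hu x).continuousAt

theorem norm_sq_eq_re_im (z : ℂ) : ‖z‖ ^ 2 = z.re ^ 2 + z.im ^ 2 := by
  rw [Complex.sq_norm, Complex.normSq_apply]; ring

theorem intervalIntegral_norm_sq {u : ℝ → ℂ} (cu : Continuous u) (a b : ℝ) :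
    ∫ x in a..b, ‖u x‖ ^ 2 = (∫ x in a..b, (u x).re ^ 2) + ∫ x in a..b, (u x).im ^ 2 := by
  rw [← intervalIntegral.integral_add (Continuous.intervalIntegrable (by fun_prop) _ _)
    (Continuous.intervalIntegrable (by fun_prop) _ _)]
  simp only [norm_sq_eq_re_im]

/-- The equation `u'' = (|x| - lam) u - f` with `v = u'`, for complex-valued functions. -/
structure IsSolution (lam : ℝ) (u v f : ℝ → ℂ) : Prop where
  hasDerivAt : ∀ x, HasDerivAt u (v x) x
  hasDerivAt_deriv : ∀ x, HasDerivAt v (((|x| - lam : ℝ) : ℂ) * u x - f x) x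
  continuous_rhs : Continuous f

namespace IsSolution

variable {lam : ℝ} {u v f : ℝ → ℂ}

theorem continuous (h : IsSolution lam u v f) : Continuous u :=
  continuous_of_hasDerivAt_complex h.hasDerivAt

theorem continuous_deriv (h : IsSolution lam u v f) : Continuous v :=
  continuous_of_hasDerivAt_complex h.hasDerivAt_deriv

theorem re_deriv (h : IsSolution lam u v f) (x : ℝ) :
    HasDerivAt (fun t => (v t).re) ((|x| - lam) * (u x).re - (f x).re) x := by
  have := hasDerivAt_re (h.hasDerivAt_deriv x)
  rwa [Complex.sub_re, Complex.re_ofReal_mul] at this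

theorem im_deriv (h : IsSolution lam u v f) (x : ℝ) :
    HasDerivAt (fun t => (v t).im) ((|x| - lam) * (u x).im - (f x).im) x := by
  have := hasDerivAt_im (h.hasDerivAt_deriv x)
  rwa [Complex.sub_im, Complex.im_ofReal_mul] at this

theorem norm_sq_le_unit_window (h : IsSolution lam u v f) {a y : ℝ} (hy : y ∈ Set.Icc a (a + 1)) :
    ‖u y‖ ^ 2 ≤ 60 * (∫ x in (a - 1)..(a + 2), ‖u x‖ ^ 2) +
      8 / max 1 (lam - |a|) * ∫ x in (a - 1)..(a + 2), ‖f x‖ ^ 2 := by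
  have cf := h.continuous_rhs
  have h1 := sq_le_unit_window (fun x => hasDerivAt_re (h.hasDerivAt x)) h.re_deriv
    (by fun_prop) hy
  have h2 := sq_le_unit_window (fun x => hasDerivAt_im (h.hasDerivAt x)) h.im_deriv
    (by fun_prop) hy
  rw [norm_sq_eq_re_im, intervalIntegral_norm_sq h.continuous,
    intervalIntegral_norm_sq h.continuous_rhs]
  linarith

theorem norm_sq_le_long_window (h : IsSolution lam u v f) {ℓ y : ℝ} (hℓ : 1 ≤ ℓ)
    (hlam : 100 * ℓ ^ 4 ≤ lam) (hy : |y| ≤ ℓ / 2) :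
    ‖u y‖ ^ 2 ≤ 9 / ℓ * (∫ x in (-(3 / 2 * ℓ))..(3 / 2 * ℓ), ‖u x‖ ^ 2) +
      8 * ℓ / lam * ∫ x in (-(3 / 2 * ℓ))..(3 / 2 * ℓ), ‖f x‖ ^ 2 := by
  have cf := h.continuous_rhs
  have h1 := sq_le_long_window (fun x => hasDerivAt_re (h.hasDerivAt x)) h.re_deriv
    (by fun_prop) hℓ hlam hy
  have h2 := sq_le_long_window (fun x => hasDerivAt_im (h.hasDerivAt x)) h.im_deriv
    (by fun_prop) hℓ hlam hy
  rw [norm_sq_eq_re_im, intervalIntegral_norm_sq h.continuous,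
    intervalIntegral_norm_sq h.continuous_rhs]
  linarith

end IsSolution

/-! ### Cauchy uniqueness and regularity of eigenfunctions. -/

/-- Uniqueness for the Cauchy problem. -/
theorem eq_zero_of_initial {mu : ℝ} {u v : ℝ → ℂ} (h : IsSolution mu u v 0) {x₀ : ℝ}
    (h0 : u x₀ = 0) (h1 : v x₀ = 0) (x : ℝ) : u x = 0 := by
  set X := |x - x₀| + 1 with hX
  have hx : x ∈ Set.Icc (x₀ - X) (x₀ + X) := by
    constructor <;> linarith [neg_abs_le (x - x₀), le_abs_self (x - x₀)]
  have hx₀ : x₀ ∈ Set.Ioo (x₀ - X) (x₀ + X) := by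
    constructor <;> linarith [abs_nonneg (x - x₀)]
  set K : NNReal := Real.toNNReal (1 + (|x₀| + X + |mu|)) with hK
  have hlip : ∀ t ∈ Set.Ioo (x₀ - X) (x₀ + X), LipschitzOnWith K
      (fun z : ℂ × ℂ => (z.2, ((|t| - mu : ℝ) : ℂ) * z.1)) Set.univ := by
    intro t ht
    refine LipschitzOnWith.of_dist_le_mul fun z _ w _ => ?_
    have hq : |(|t| - mu)| ≤ |x₀| + X + |mu| := by
      have h3 : |t| ≤ |x₀| + X := by
        rw [abs_le]
        constructor <;> linarith [neg_abs_le x₀, le_abs_self x₀, ht.1, ht.2]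
      rw [abs_le]
      constructor <;> linarith [neg_abs_le mu, le_abs_self mu, abs_nonneg t]
    have hq0 : 0 ≤ |x₀| + X + |mu| := (abs_nonneg _).trans hq
    rw [hK, Real.coe_toNNReal _ (by positivity), dist_eq_norm, dist_eq_norm, Prod.norm_def]
    have e1 : ‖(z - w).1‖ ≤ ‖z - w‖ := norm_fst_le _
    have e2 : ‖(z - w).2‖ ≤ ‖z - w‖ := norm_snd_le _
    have e3 := norm_nonneg (z - w)
    refine max_le ?_ ?_
    · simp only [Prod.snd_sub, Prod.fst_sub] at *
      nlinarith [mul_nonneg hq0 e3]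
    · simp only [Prod.snd_sub, Prod.fst_sub] at *
      rw [← mul_sub, norm_mul, Complex.norm_real, Real.norm_eq_abs]
      nlinarith [mul_le_mul hq e1 (norm_nonneg _) hq0]
  have := ODE_solution_unique_of_mem_Icc (E := ℂ × ℂ)
    (v := fun t z => (z.2, ((|t| - mu : ℝ) : ℂ) * z.1)) (s := fun _ => Set.univ) (t₀ := x₀)
    (a := x₀ - X) (b := x₀ + X) (f := fun t => (u t, v t)) (g := fun _ => 0) hlip hx₀
    (h.continuous.prodMk h.continuous_deriv).continuousOn
    (fun t _ => by
      have h2 := h.hasDerivAt_deriv t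
      simp only [Pi.zero_apply, sub_zero] at h2
      exact (h.hasDerivAt t).prodMk h2) (fun t _ => trivial) continuousOn_const
    (fun t _ => by
      convert! hasDerivAt_const t (0 : ℂ × ℂ) using 1
      simp) (fun t _ => trivial) (by simp [h0, h1])
  exact congrArg Prod.fst (this hx)

theorem absolutelyContinuousOnInterval_of_hasDerivAt {G q : ℝ → ℂ}
    (hG : ∀ x, HasDerivAt G (q x) x) (cq : Continuous q) (a b : ℝ) :
    AbsolutelyContinuousOnInterval G a b := by
  obtain ⟨K, hK⟩ := (isCompact_uIcc (a := a) (b := b)).exists_bound_of_continuousOn cq.continuousOn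
  have : LipschitzOnWith K.toNNReal G (Set.uIcc a b) := by
    refine (convex_uIcc _ _).lipschitzOnWith_of_nnnorm_hasDerivWithin_le
      (fun t _ => (hG t).hasDerivWithinAt) fun t ht => ?_
    rw [← NNReal.coe_le_coe, coe_nnnorm]
    exact (hK t ht).trans (Real.le_coe_toNNReal K)
  exact this.absolutelyContinuousOnInterval

/-- Eigenfunctions are classical solutions. -/
theorem MemDomain.isSolution {mu : ℝ} {u : ℝ → ℂ} (hu : MemDomain u)
    (he : ∀ᵐ x : ℝ, H u x = (mu : ℂ) * u x) : IsSolution mu u (deriv u) 0 := by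
  have cu : Continuous u := hu.differentiable.continuous
  set q : ℝ → ℂ := fun x => ((|x| - mu : ℝ) : ℂ) * u x with hq
  have cq : Continuous q := by fun_prop
  set G : ℝ → ℂ := fun x => ∫ t in (0 : ℝ)..x, q t with hG
  have hGd : ∀ x, HasDerivAt G (q x) x := fun x => cq.integral_hasStrictDerivAt 0 x |>.hasDerivAt
  have key : ∀ x, deriv u x = G x + deriv u 0 := by
    intro x
    set X := |x| with hX
    -- An absolutely continuous function with derivative zero almost everywhere is constant, so u'
    -- is the primitive of a continuous function plus a constant.
    have hac : AbsolutelyContinuousOnInterval (deriv u - G) (-X) X :=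
      (hu.absolutelyContinuous (-X) X).sub (absolutelyContinuousOnInterval_of_hasDerivAt hGd cq _ _)
    have hae : ∀ᵐ t, t ∈ Set.uIcc (-X) X → HasDerivAt (deriv u - G) 0 t := by
      filter_upwards [he, 
        (hu.absolutelyContinuous (-X) X).boundedVariationOn.ae_differentiableAt_of_mem_uIcc] with t h1 h2 ht
      have h3 := (h2 ht).hasDerivAt.sub (hGd t)
      have h4 : deriv (deriv u) t - q t = 0 := by
        simp only [H] at h1
        simp only [hq]
        push_cast
        linear_combination -h1
      rwa [h4] at h3
    obtain ⟨C, hC⟩ := hac.const_of_ae_hasDerivAt_zero hae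
    have e1 := hC x (by
      rw [Set.uIcc_of_le (by linarith [abs_nonneg x])]
      exact ⟨neg_abs_le x, le_abs_self x⟩)
    have e2 := hC 0 (by
      rw [Set.uIcc_of_le (by linarith [abs_nonneg x])]
      exact ⟨by linarith [abs_nonneg x], abs_nonneg x⟩)
    have e3 : G 0 = 0 := intervalIntegral.integral_same
    rw [Pi.sub_apply] at e1 e2
    rw [e3, sub_zero] at e2
    rw [e2, ← e1]; ring
  refine ⟨fun x => (hu.differentiable x).hasDerivAt, fun x => ?_, continuous_const⟩
  have h2 : HasDerivAt (fun x => G x + deriv u 0) (q x) x := (hGd x).add_const _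
  have h3 : deriv u = fun x => G x + deriv u 0 := funext key
  rw [h3]
  simpa [hq] using h2

/-! ### Global integrability from estimates on growing windows. -/

/-- The windows are centred at 0 but written as a..a + ℓ with a = -ℓ/2, the shape of the inner
interval of the cutoff. -/
theorem integrable_and_integral_le_of_forall_le {h : ℝ → ℝ} (ch : Continuous h) (h0 : ∀ x, 0 ≤ h x)
    {K : ℝ} (hK : ∀ ℓ : ℝ, 1 ≤ ℓ → ∫ x in (-(ℓ / 2))..(-(ℓ / 2) + ℓ), h x ≤ K) :
    Integrable h ∧ ∫ x, h x ≤ K := by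
  have ta : Tendsto (fun ℓ : ℝ => -(ℓ / 2)) atTop atBot :=
    tendsto_neg_atTop_atBot.comp (tendsto_id.atTop_div_const two_pos)
  have tb : Tendsto (fun ℓ : ℝ => -(ℓ / 2) + ℓ) atTop atTop := by
    have : (fun ℓ : ℝ => -(ℓ / 2) + ℓ) = fun ℓ => ℓ / 2 := by ext; ring
    rw [this]
    exact tendsto_id.atTop_div_const two_pos
  have hi : Integrable h := by
    refine integrable_of_intervalIntegral_norm_bounded K
      (fun ℓ => ch.integrableOn_Ioc) ta tb ?_
    filter_upwards [eventually_ge_atTop 1] with ℓ hℓ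
    simpa only [Real.norm_of_nonneg (h0 _)] using hK ℓ hℓ
  refine ⟨hi, le_of_tendsto (intervalIntegral_tendsto_integral hi ta tb) ?_⟩
  filter_upwards [eventually_ge_atTop 1] with ℓ hℓ using hK ℓ hℓ

theorem intervalIntegral_le_integral {h : ℝ → ℝ} (hi : Integrable h) (h0 : ∀ x, 0 ≤ h x) {a b : ℝ}
    (hab : a ≤ b) : ∫ x in a..b, h x ≤ ∫ x, h x := by
  rw [intervalIntegral.integral_of_le hab]
  exact setIntegral_le_integral hi (ae_of_all _ h0)

theorem integrable_deriv_sq {u v : ℝ → ℝ} {mu : ℝ} (hu : ∀ x, HasDerivAt u (v x) x)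
    (hv : ∀ x, HasDerivAt v ((|x| - mu) * u x) x) (hi : Integrable fun x => u x ^ 2) :
    Integrable fun x => v x ^ 2 := by
  have cu := continuous_of_hasDerivAt hu
  have cv := continuous_of_hasDerivAt hv
  refine (integrable_and_integral_le_of_forall_le (by fun_prop) (fun x => sq_nonneg _)
    (K := 3 * (|mu| * ∫ x, u x ^ 2) + 9 * ∫ x, u x ^ 2) fun ℓ hℓ => ?_).1
  have hℓ0 : 0 < ℓ := by linarith
  refine (integral_deriv_sq_le (h := fun x => |mu| * u x ^ 2) hu hv (by fun_prop) (by fun_prop)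
    hℓ0 (fun x => by positivity) fun x _ => ?_).trans ?_
  · nlinarith [mul_nonneg (abs_nonneg x) (sq_nonneg (u x)),
      mul_nonneg (sub_nonneg.2 (le_abs_self mu)) (sq_nonneg (u x))]
  · rw [intervalIntegral.integral_const_mul]
    have h1 := intervalIntegral_le_integral hi (fun x => sq_nonneg _)
      (by linarith : -(ℓ / 2) - ℓ ≤ -(ℓ / 2) + 2 * ℓ)
    have h2 : 9 / ℓ ^ 2 ≤ 9 := div_le_self (by norm_num) (one_le_pow₀ hℓ)
    have h3 : 0 ≤ ∫ x, u x ^ 2 := integral_nonneg fun x => sq_nonneg _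
    have h4 : 0 ≤ 9 / ℓ ^ 2 := by positivity
    have := mul_le_mul h2 h1 (intervalIntegral.integral_nonneg (by linarith)
      fun x _ => sq_nonneg _) (by norm_num)
    have := mul_le_mul_of_nonneg_left h1 (abs_nonneg mu)
    linarith

/-- Caccioppoli bounds the χ²-weighted integral of (|x| - mu)u²; replacing -mu by nu costs (mu +
nu)u². The shift nu makes the weight nonnegative and mu + nu ≥ 0 without knowing the sign of mu. -/
theorem integral_potential_mul_sq_le {u v : ℝ → ℝ} {mu nu : ℝ} (hu : ∀ x, HasDerivAt u (v x) x)
    (hv : ∀ x, HasDerivAt v ((|x| - mu) * u x) x) (hi : Integrable fun x => u x ^ 2)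
    (hnu : 0 ≤ nu) (hmn : 0 ≤ mu + nu) :
    Integrable (fun x => (|x| + nu) * u x ^ 2) ∧
      ∫ x, (|x| + nu) * u x ^ 2 ≤ (2 * (mu + nu) + 5) * ∫ x, u x ^ 2 := by
  have cu := continuous_of_hasDerivAt hu
  have cv := continuous_of_hasDerivAt hv
  refine integrable_and_integral_le_of_forall_le (by fun_prop) (fun x => by positivity)
    fun ℓ hℓ => ?_
  have hℓ0 : 0 < ℓ := by linarith
  have cχ := continuous_cutoff (-(ℓ / 2)) ℓ
  have key := caccioppoli hu hv (by fun_prop) (a := -(ℓ / 2)) hℓ0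
  have h1 := intervalIntegral_le_integral hi (fun x => sq_nonneg _)
    (by linarith : -(ℓ / 2) - ℓ ≤ -(ℓ / 2) + 2 * ℓ)
  have h2 : 18 / ℓ ^ 2 ≤ 18 := div_le_self (by norm_num) (one_le_pow₀ hℓ)
  have h3 : 0 ≤ ∫ x in (-(ℓ / 2) - ℓ)..(-(ℓ / 2) + 2 * ℓ), u x ^ 2 :=
    intervalIntegral.integral_nonneg (by linarith) fun x _ => sq_nonneg _
  have h4 : 4 * (∫ x in (-(ℓ / 2))..(-(ℓ / 2) + ℓ), (|x| + nu) * u x ^ 2) ≤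
      ∫ x in (-(ℓ / 2) - ℓ)..(-(ℓ / 2) + 2 * ℓ),
        cutoff (-(ℓ / 2)) ℓ x ^ 2 * ((|x| + nu) * u x ^ 2) := by
    rw [← intervalIntegral.integral_const_mul]
    refine (intervalIntegral.integral_mono_on
      (g := fun x => cutoff (-(ℓ / 2)) ℓ x ^ 2 * ((|x| + nu) * u x ^ 2))
      (by linarith) (Continuous.intervalIntegrable (by fun_prop) _ _)
      (Continuous.intervalIntegrable (by fun_prop) _ _) fun x hx => ?_).trans ?_
    · exact mul_le_mul_of_nonneg_right (four_le_cutoff_sq hℓ0 hx) (by positivity)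
    · exact intervalIntegral.integral_mono_interval (by linarith) (by linarith) (by linarith)
        (ae_of_all _ fun x => by positivity) (Continuous.intervalIntegrable (by fun_prop) _ _)
  have h5 : ∫ x in (-(ℓ / 2) - ℓ)..(-(ℓ / 2) + 2 * ℓ),
        cutoff (-(ℓ / 2)) ℓ x ^ 2 * ((|x| + nu) * u x ^ 2) ≤
      (∫ x in (-(ℓ / 2) - ℓ)..(-(ℓ / 2) + 2 * ℓ), cutoff (-(ℓ / 2)) ℓ x ^ 2 *
        (1 / 2 * v x ^ 2 + (|x| - mu) * u x * u x)) +
      81 / 16 * (mu + nu) * ∫ x in (-(ℓ / 2) - ℓ)..(-(ℓ / 2) + 2 * ℓ), u x ^ 2 := by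
    rw [← intervalIntegral.integral_const_mul, ← intervalIntegral.integral_add
      (Continuous.intervalIntegrable (by fun_prop) _ _)
      (Continuous.intervalIntegrable (by fun_prop) _ _)]
    refine intervalIntegral.integral_mono_on (by linarith)
      (Continuous.intervalIntegrable (by fun_prop) _ _)
      (Continuous.intervalIntegrable (by fun_prop) _ _) fun x hx => ?_
    nlinarith [mul_nonneg (mul_nonneg (sub_nonneg.2 (cutoff_sq_le hℓ0 hx)) hmn) (sq_nonneg (u x)),
      mul_nonneg (sq_nonneg (cutoff (-(ℓ / 2)) ℓ x)) (sq_nonneg (v x))]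
  have h6 := mul_le_mul_of_nonneg_left h1 hmn
  have h7 := mul_le_mul_of_nonneg_right h2 h3
  have h8 := mul_nonneg hmn h3
  nlinarith

/-! ### Eigenfunctions: orthogonality, simplicity, zeros, localization. -/

/-- An `L²` function solving `u'' = (|x| - mu) u` classically. -/
structure IsClassicalEigenfunction (mu : ℝ) (u : ℝ → ℂ) : Prop where
  isSolution : IsSolution mu u (deriv u) 0
  memLp : MemLp u 2 volume

namespace IsClassicalEigenfunction

variable {mu nu : ℝ} {u w : ℝ → ℂ}

theorem continuous (h : IsClassicalEigenfunction mu u) : Continuous u := h.isSolution.continuous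

theorem continuous_deriv (h : IsClassicalEigenfunction mu u) : Continuous (deriv u) :=
  h.isSolution.continuous_deriv

theorem hasDerivAt (h : IsClassicalEigenfunction mu u) (x : ℝ) : HasDerivAt u (deriv u x) x :=
  h.isSolution.hasDerivAt x

theorem hasDerivAt_deriv (h : IsClassicalEigenfunction mu u) (x : ℝ) :
    HasDerivAt (deriv u) (((|x| - mu : ℝ) : ℂ) * u x) x := by
  simpa using h.isSolution.hasDerivAt_deriv x

theorem integrable_norm_sq (h : IsClassicalEigenfunction mu u) :
    Integrable fun x => ‖u x‖ ^ 2 :=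
  (memLp_two_iff_integrable_sq_norm h.memLp.aestronglyMeasurable).1 h.memLp

theorem integrable_re_sq (h : IsClassicalEigenfunction mu u) :
    Integrable fun x => (u x).re ^ 2 := by
  have cu := h.continuous
  refine h.integrable_norm_sq.mono' (Continuous.aestronglyMeasurable (by fun_prop))
    (ae_of_all _ fun x => ?_)
  rw [Real.norm_of_nonneg (sq_nonneg _), norm_sq_eq_re_im]
  linarith [sq_nonneg (u x).im]

theorem integrable_im_sq (h : IsClassicalEigenfunction mu u) :
    Integrable fun x => (u x).im ^ 2 := by
  have cu := h.continuous
  refine h.integrable_norm_sq.mono' (Continuous.aestronglyMeasurable (by fun_prop))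
    (ae_of_all _ fun x => ?_)
  rw [Real.norm_of_nonneg (sq_nonneg _), norm_sq_eq_re_im]
  linarith [sq_nonneg (u x).re]

theorem memLp_deriv (h : IsClassicalEigenfunction mu u) : MemLp (deriv u) 2 volume := by
  rw [memLp_two_iff_integrable_sq_norm h.continuous_deriv.aestronglyMeasurable]
  have h1 := integrable_deriv_sq (fun x => hasDerivAt_re (h.hasDerivAt x))
    (fun x => by simpa using h.isSolution.re_deriv x) h.integrable_re_sq
  have h2 := integrable_deriv_sq (fun x => hasDerivAt_im (h.hasDerivAt x))
    (fun x => by simpa using h.isSolution.im_deriv x) h.integrable_im_sq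
  simp only [norm_sq_eq_re_im]
  exact h1.add h2

theorem integrable_mul_conj (h : IsClassicalEigenfunction mu u)
    (h' : IsClassicalEigenfunction nu w) :
    Integrable fun x => u x * (starRingEnd ℂ) (w x) :=
  h.memLp.integrable_mul h'.memLp.star

/-- Green's identity: (mu - nu)u·conj w is the derivative of a Wronskian that is integrable because
u' and w' are in L², so its integral vanishes. -/
theorem integral_mul_conj_eq_zero (h : IsClassicalEigenfunction mu u)
    (h' : IsClassicalEigenfunction nu w) (hne : mu ≠ nu) :
    ∫ x, u x * (starRingEnd ℂ) (w x) = 0 := by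
  have hd : ∀ x, HasDerivAt (fun x => u x * (starRingEnd ℂ) (deriv w x) -
      deriv u x * (starRingEnd ℂ) (w x))
      (((mu - nu : ℝ) : ℂ) * (u x * (starRingEnd ℂ) (w x))) x := fun x => by
    convert! ((h.hasDerivAt x).mul (hasDerivAt_conj (h'.hasDerivAt_deriv x))).sub
      ((h.hasDerivAt_deriv x).mul (hasDerivAt_conj (h'.hasDerivAt x))) using 1
    rw [map_mul, Complex.conj_ofReal]
    push_cast; ring
  have h0 := integral_eq_zero_of_hasDerivAt_of_integrable hd
    ((h.integrable_mul_conj h').const_mul _)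
    ((h.memLp.integrable_mul h'.memLp_deriv.star).sub
      (h.memLp_deriv.integrable_mul h'.memLp.star))
  rw [integral_const_mul] at h0
  refine (mul_eq_zero.1 h0).resolve_left ?_
  exact_mod_cast sub_ne_zero.2 hne

/-- The Wronskian is constant, and integrable over a line of infinite measure. -/
theorem wronskian_eq_zero (h : IsClassicalEigenfunction mu u)
    (h' : IsClassicalEigenfunction mu w) (x : ℝ) : u x * deriv w x = deriv u x * w x := by
  have hd : ∀ x, HasDerivAt (fun x => u x * deriv w x - deriv u x * w x) 0 x := fun x => by
    convert! ((h.hasDerivAt x).mul (h'.hasDerivAt_deriv x)).sub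
      ((h.hasDerivAt_deriv x).mul (h'.hasDerivAt x)) using 1
    ring
  have hc : ∀ y, u y * deriv w y - deriv u y * w y = u x * deriv w x - deriv u x * w x := fun y =>
    is_const_of_deriv_eq_zero (fun t => (hd t).differentiableAt) (fun t => (hd t).deriv) y x
  have hi : Integrable fun y => u y * deriv w y - deriv u y * w y :=
    (h.memLp.integrable_mul h'.memLp_deriv).sub (h.memLp_deriv.integrable_mul h'.memLp)
  simp only [hc] at hi
  rw [integrable_const_iff] at hi
  rcases hi with hi | hi
  · exact sub_eq_zero.1 hi
  · exact absurd hi (by simp [isFiniteMeasure_iff])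

theorem eq_zero_of_initial (h : IsClassicalEigenfunction mu u) {x₀ : ℝ} (h0 : u x₀ = 0)
    (h1 : deriv u x₀ = 0) : u = 0 :=
  funext (AnharmonicOscillator.eq_zero_of_initial h.isSolution h0 h1)

theorem sub_const_mul (h : IsClassicalEigenfunction mu u) (h' : IsClassicalEigenfunction mu w)
    (z : ℂ) : IsClassicalEigenfunction mu fun x => u x - z * w x := by
  have hd : ∀ x, HasDerivAt (fun x => u x - z * w x) (deriv u x - z * deriv w x) x := fun x =>
    (h.hasDerivAt x).sub ((h'.hasDerivAt x).const_mul z)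
  have e : deriv (fun x => u x - z * w x) = fun x => deriv u x - z * deriv w x :=
    funext fun x => (hd x).deriv
  refine ⟨⟨fun x => (hd x).differentiableAt.hasDerivAt, fun x => ?_, continuous_const⟩,
    h.memLp.sub (h'.memLp.const_mul z)⟩
  rw [e]
  convert! (h.hasDerivAt_deriv x).sub ((h'.hasDerivAt_deriv x).const_mul z) using 1
  simp; ring

/-- The eigenvalues are simple. -/
theorem exists_eq_const_mul (h : IsClassicalEigenfunction mu u)
    (h' : IsClassicalEigenfunction mu w) (hw : w ≠ 0) : ∃ z : ℂ, ∀ x, u x = z * w x := by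
  have hW := h.wronskian_eq_zero h' 0
  -- It is enough to match the Cauchy data at 0. The two conditions on z are compatible because the
  -- Wronskian vanishes.
  suffices ∃ z : ℂ, u 0 = z * w 0 ∧ deriv u 0 = z * deriv w 0 by
    obtain ⟨z, h0, h1⟩ := this
    refine ⟨z, fun x => ?_⟩
    have e := (h.sub_const_mul h' z).eq_zero_of_initial (x₀ := 0) (by simp [h0]) (
      ((((h.hasDerivAt 0).sub ((h'.hasDerivAt 0).const_mul z)).deriv).trans (by
        rw [h1, sub_self])))
    exact sub_eq_zero.1 (congrFun e x)
  by_cases h0 : w 0 = 0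
  · have h1 : deriv w 0 ≠ 0 := fun h1 => hw (h'.eq_zero_of_initial h0 h1)
    refine ⟨deriv u 0 / deriv w 0, ?_, by field_simp⟩
    rw [h0, mul_zero] at hW ⊢
    exact (mul_eq_zero.1 hW).resolve_right h1
  · refine ⟨u 0 / w 0, by field_simp, ?_⟩
    field_simp
    linear_combination -hW

theorem norm_eq_norm (h : IsClassicalEigenfunction mu u) (h' : IsClassicalEigenfunction mu w)
    (hu : ∫ x, ‖u x‖ ^ 2 = 1) (hw : ∫ x, ‖w x‖ ^ 2 = 1) (x : ℝ) : ‖u x‖ = ‖w x‖ := by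
  obtain ⟨z, hz⟩ := h.exists_eq_const_mul h' (by rintro rfl; simp at hw)
  simp only [hz, norm_mul, mul_pow] at hu
  rw [integral_const_mul, hw, mul_one] at hu
  have : ‖z‖ = 1 := by nlinarith [norm_nonneg z]
  rw [hz, norm_mul, this, one_mul]

/-- A nonzero eigenfunction vanishes only on a null set. -/
theorem ae_ne_zero (h : IsClassicalEigenfunction mu u) (hu : u ≠ 0) : ∀ᵐ x, u x ≠ 0 := by
  -- Zeros are simple by Cauchy uniqueness, hence isolated.
  have key : ∀ x, ∀ᶠ y in nhdsWithin x {x}ᶜ, u y ≠ 0 := fun x => by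
    by_cases h0 : u x = 0
    · have h1 : deriv u x ≠ 0 := fun h1 => hu (h.eq_zero_of_initial h0 h1)
      simpa [h0] using (h.hasDerivAt x).eventually_ne h1 (c := 0)
    · exact (h.continuous.continuousAt.eventually_ne h0).filter_mono nhdsWithin_le_nhds
  have hc : {x | u x ≠ 0} ∈ codiscreteWithin (Set.univ : Set ℝ) := by
    rw [mem_codiscreteWithin]
    intro x _
    rw [disjoint_principal_right]
    filter_upwards [key x] with y hy
    simpa using hy
  have := ae_restrict_le_codiscreteWithin (μ := volume) MeasurableSet.univ hc
  rwa [Measure.restrict_univ] at this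

theorem setIntegral_pos (h : IsClassicalEigenfunction mu u) (hu : u ≠ 0) {E : Set ℝ}
    (hE : volume E ≠ 0) : 0 < ∫ x in E, ‖u x‖ ^ 2 := by
  rw [integral_pos_iff_support_of_nonneg_ae (ae_of_all _ fun x => sq_nonneg _)
    h.integrable_norm_sq.integrableOn]
  have h1 : ∀ᵐ x ∂(volume.restrict E), x ∈ Function.support fun x => ‖u x‖ ^ 2 := by
    filter_upwards [ae_restrict_of_ae (h.ae_ne_zero hu)] with x hx
    simpa using hx
  rw [measure_eq_measure_of_null_sdiff (Set.subset_univ _) (by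
    rw [← Set.compl_eq_univ_sdiff]; exact h1)]
  simpa [pos_iff_ne_zero] using hE

theorem integrable_abs_mul_norm_sq (h : IsClassicalEigenfunction mu u) :
    Integrable (fun x => (|x| + |mu|) * ‖u x‖ ^ 2) ∧
      ∫ x, (|x| + |mu|) * ‖u x‖ ^ 2 ≤ (2 * (mu + |mu|) + 5) * ∫ x, ‖u x‖ ^ 2 := by
  have h1 := integral_potential_mul_sq_le (fun x => hasDerivAt_re (h.hasDerivAt x))
    (fun x => by simpa using h.isSolution.re_deriv x) h.integrable_re_sq (abs_nonneg mu)
    (by linarith [neg_abs_le mu])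
  have h2 := integral_potential_mul_sq_le (fun x => hasDerivAt_im (h.hasDerivAt x))
    (fun x => by simpa using h.isSolution.im_deriv x) h.integrable_im_sq (abs_nonneg mu)
    (by linarith [neg_abs_le mu])
  simp only [norm_sq_eq_re_im, mul_add (|_| + |mu|)]
  rw [integral_add h1.1 h2.1, integral_add h.integrable_re_sq h.integrable_im_sq]
  exact ⟨h1.1.add h2.1, by linarith [h1.2, h2.2]⟩

/-- For negative mu the factor mu + |mu| is zero, so the weighted mass is at most 5, yet it is at
least -mu. This crude bound suffices for finiteness below a level. -/
theorem neg_five_le (h : IsClassicalEigenfunction mu u) (hu : ∫ x, ‖u x‖ ^ 2 = 1) : -5 ≤ mu := by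
  by_contra! hlt
  have h1 := h.integrable_abs_mul_norm_sq
  rw [hu, abs_of_neg (by linarith)] at h1
  have h2 : ∫ x, (-mu) * ‖u x‖ ^ 2 ≤ ∫ x, (|x| + -mu) * ‖u x‖ ^ 2 :=
    integral_mono (h.integrable_norm_sq.const_mul _) h1.1 fun x => by
      nlinarith [mul_nonneg (abs_nonneg x) (sq_nonneg ‖u x‖)]
  rw [integral_const_mul, hu] at h2
  linarith

/-- Localization of the eigenfunctions. -/
theorem half_le_integral (h : IsClassicalEigenfunction mu u) (hu : ∫ x, ‖u x‖ ^ 2 = 1) {L X : ℝ}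
    (hL : |mu| ≤ L) (hX : 8 * L + 10 ≤ X) : 1 / 2 ≤ ∫ x in Set.Icc (-X) X, ‖u x‖ ^ 2 := by
  have h1 := h.integrable_abs_mul_norm_sq
  have hX0 : 0 < X := by linarith [abs_nonneg mu]
  rw [hu] at h1
  -- Chebyshev: the mass outside [-X, X] is at most (4L + 5)/X ≤ 1/2.
  have h2 : ∫ x, ‖u x‖ ^ 2 ≤ ∫ x, (1 / X * ((|x| + |mu|) * ‖u x‖ ^ 2) +
      (Set.Icc (-X) X).indicator (fun x => ‖u x‖ ^ 2) x) := by
    refine integral_mono h.integrable_norm_sq ((h1.1.const_mul _).add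
      (h.integrable_norm_sq.indicator measurableSet_Icc)) fun x => ?_
    by_cases hx : x ∈ Set.Icc (-X) X
    · simp only [Set.indicator_of_mem hx]
      have : 0 ≤ 1 / X * ((|x| + |mu|) * ‖u x‖ ^ 2) := by positivity
      linarith
    · simp only [Set.indicator_of_notMem hx, add_zero]
      have h3 : X ≤ |x| := by
        rw [Set.mem_Icc, ← abs_le, not_le] at hx
        exact hx.le
      rw [one_div, le_inv_mul_iff₀ hX0]
      exact mul_le_mul_of_nonneg_right (by linarith [abs_nonneg mu]) (sq_nonneg _)
  rw [integral_add (h1.1.const_mul _) (h.integrable_norm_sq.indicator measurableSet_Icc),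
    integral_const_mul, hu, integral_indicator measurableSet_Icc] at h2
  have h4 : 1 / X * ∫ x, (|x| + |mu|) * ‖u x‖ ^ 2 ≤ 1 / 2 := by
    rw [one_div, inv_mul_le_iff₀ hX0]
    linarith [le_abs_self mu]
  linarith

end IsClassicalEigenfunction

theorem IsNormalizedEigenfunction.isClassicalEigenfunction {mu : ℝ} {u : ℝ → ℂ}
    (h : IsNormalizedEigenfunction mu u) : IsClassicalEigenfunction mu u :=
  ⟨h.memDomain.isSolution h.eigen, h.memDomain.memLp⟩

/-! ### Finite combinations of eigenfunctions. -/

/-- Finite linear combinations of eigenfunctions solve the inhomogeneous equation. -/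
theorem isSolution_sum {ι : Type*} (T : Finset ι) {mu : ι → ℝ} {φ : ι → ℝ → ℂ}
    (h : ∀ i ∈ T, IsClassicalEigenfunction (mu i) (φ i)) (c : ι → ℂ) (lam : ℝ) :
    IsSolution lam (fun x => ∑ i ∈ T, c i * φ i x) (fun x => ∑ i ∈ T, c i * deriv (φ i) x)
      (fun x => ∑ i ∈ T, (c i * ((mu i - lam : ℝ) : ℂ)) * φ i x) := by
  refine ⟨fun x => ?_, fun x => ?_, ?_⟩
  · exact HasDerivAt.fun_sum fun i hi => ((h i hi).hasDerivAt x).const_mul (c i)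
  · convert! HasDerivAt.fun_sum fun i hi => ((h i hi).hasDerivAt_deriv x).const_mul (c i) using 1
    rw [Finset.mul_sum, ← Finset.sum_sub_distrib]
    refine Finset.sum_congr rfl fun i _ => ?_
    push_cast; ring
  · exact continuous_finsetSum _ fun i hi => continuous_const.mul (h i hi).continuous

theorem memLp_sum {ι : Type*} (T : Finset ι) {mu : ι → ℝ} {φ : ι → ℝ → ℂ}
    (h : ∀ i ∈ T, IsClassicalEigenfunction (mu i) (φ i)) (c : ι → ℂ) :
    MemLp (fun x => ∑ i ∈ T, c i * φ i x) 2 volume :=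
  memLp_finsetSum _ fun i hi => (h i hi).memLp.const_mul (c i)

theorem integrable_norm_sq_sum {ι : Type*} (T : Finset ι) {mu : ι → ℝ} {φ : ι → ℝ → ℂ}
    (h : ∀ i ∈ T, IsClassicalEigenfunction (mu i) (φ i)) (c : ι → ℂ) :
    Integrable (fun x => ‖∑ i ∈ T, c i * φ i x‖ ^ 2) :=
  (memLp_two_iff_integrable_sq_norm (memLp_sum T h c).aestronglyMeasurable).1 (memLp_sum T h c)

/-- Parseval's identity for finite linear combinations of normalized eigenfunctions. -/
theorem integral_norm_sq_sum {ι : Type*} (T : Finset ι) {mu : ι → ℝ} {φ : ι → ℝ → ℂ}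
    (h : ∀ i ∈ T, IsClassicalEigenfunction (mu i) (φ i)) (hn : ∀ i ∈ T, ∫ x, ‖φ i x‖ ^ 2 = 1)
    (hinj : Set.InjOn mu T) (c : ι → ℂ) :
    ∫ x, ‖∑ i ∈ T, c i * φ i x‖ ^ 2 = ∑ i ∈ T, ‖c i‖ ^ 2 := by
  classical
  have hg : ∀ i ∈ T, ∀ j ∈ T, ∫ x, φ i x * (starRingEnd ℂ) (φ j x) = if i = j then 1 else 0 := by
    intro i hi j hj
    split_ifs with hij
    · subst hij
      simp only [Complex.mul_conj']
      have := congrArg (fun r : ℝ => (r : ℂ)) (hn i hi)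
      rw [← integral_complex_ofReal] at this
      simpa using this
    · exact (h i hi).integral_mul_conj_eq_zero (h j hj) fun e => hij (hinj hi hj e)
  have key : ((∫ x, ‖∑ i ∈ T, c i * φ i x‖ ^ 2 : ℝ) : ℂ) = ((∑ i ∈ T, ‖c i‖ ^ 2 : ℝ) : ℂ) := by
    rw [← integral_complex_ofReal]
    have e : ∀ x, ((‖∑ i ∈ T, c i * φ i x‖ ^ 2 : ℝ) : ℂ) = ∑ i ∈ T, ∑ j ∈ T,
        (c i * (starRingEnd ℂ) (c j)) * (φ i x * (starRingEnd ℂ) (φ j x)) := fun x => by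
      push_cast
      rw [← Complex.mul_conj', map_sum, Finset.sum_mul_sum]
      refine Finset.sum_congr rfl fun i _ => Finset.sum_congr rfl fun j _ => ?_
      rw [map_mul]; ring
    simp only [e]
    rw [integral_finsetSum _ fun i hi => integrable_finsetSum _ fun j hj =>
      ((h i hi).integrable_mul_conj (h j hj)).const_mul _]
    push_cast
    refine Finset.sum_congr rfl fun i hi => ?_
    rw [integral_finsetSum _ fun j hj => ((h i hi).integrable_mul_conj (h j hj)).const_mul _]
    rw [Finset.sum_eq_single i]
    · rw [integral_const_mul, hg i hi i hi, if_pos rfl, mul_one, Complex.mul_conj']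
    · intro j hj hji
      rw [integral_const_mul, hg i hi j hj, if_neg (Ne.symm hji), mul_zero]
    · exact fun hi' => absurd hi hi'
  exact_mod_cast key

/-! ### A decaying solution of Airy's equation. -/

/-- The integrand of Airy's integral along the line `Im z = 1`, up to a constant factor. -/
noncomputable def airyKernel (x s : ℝ) : ℂ :=
  Complex.exp (-(s : ℂ) ^ 2 + Complex.I * ((s : ℂ) ^ 3 / 3 - s) + (Complex.I * s - 1) * x)

theorem norm_airyKernel (x s : ℝ) : ‖airyKernel x s‖ = Real.exp (-s ^ 2 - x) := by
  rw [airyKernel, Complex.norm_exp]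
  congr 1
  have e : (-(s : ℂ) ^ 2 + Complex.I * ((s : ℂ) ^ 3 / 3 - s) + (Complex.I * s - 1) * x) =
      ((-s ^ 2 - x : ℝ) : ℂ) + ((s ^ 3 / 3 - s + s * x : ℝ) : ℂ) * Complex.I := by
    push_cast; ring
  rw [e, Complex.add_re, Complex.ofReal_re, Complex.re_ofReal_mul, Complex.I_re, mul_zero, add_zero]

theorem continuous_airyKernel (x : ℝ) : Continuous (airyKernel x) := by
  unfold airyKernel
  fun_prop

/-- Half of the Gaussian absorbs the polynomial, through (t/2)^n / n! ≤ exp(t/2) with t = 1 + s²;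
the other half stays as an integrable majorant. -/
theorem norm_I_mul_sub_one_pow_le (n : ℕ) (s : ℝ) :
    ‖(Complex.I * s - 1) ^ n‖ * Real.exp (-s ^ 2) ≤
      (2 ^ n * n.factorial * Real.exp (1 / 2)) * Real.exp (-(1 / 2) * s ^ 2) := by
  have h1 : ‖Complex.I * s - 1‖ ≤ 1 + s ^ 2 := by
    have : ‖Complex.I * s - 1‖ ^ 2 = 1 + s ^ 2 := by
      rw [norm_sq_eq_re_im]; simp
    nlinarith [norm_nonneg (Complex.I * s - 1), sq_nonneg s]
  have h2 := Real.pow_div_factorial_le_exp ((1 + s ^ 2) / 2) (by positivity) n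
  rw [div_le_iff₀ (by positivity), div_pow, div_le_iff₀ (by positivity)] at h2
  rw [norm_pow]
  calc ‖Complex.I * s - 1‖ ^ n * Real.exp (-s ^ 2)
      ≤ (1 + s ^ 2) ^ n * Real.exp (-s ^ 2) := by gcongr
    _ ≤ (Real.exp ((1 + s ^ 2) / 2) * n.factorial * 2 ^ n) * Real.exp (-s ^ 2) := by gcongr
    _ = (2 ^ n * n.factorial) * (Real.exp ((1 + s ^ 2) / 2) * Real.exp (-s ^ 2)) := by ring
    _ = _ := by
      rw [← Real.exp_add, mul_assoc (2 ^ n * (n.factorial : ℝ)), ← Real.exp_add]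
      congr 2; ring

theorem norm_airyMoment_le (n : ℕ) (x s : ℝ) :
    ‖(Complex.I * s - 1) ^ n * airyKernel x s‖ ≤
      (2 ^ n * n.factorial * Real.exp (1 / 2)) * Real.exp (-(1 / 2) * s ^ 2) * Real.exp (-x) := by
  rw [norm_mul, norm_airyKernel, sub_eq_add_neg (-s ^ 2) x, Real.exp_add, ← mul_assoc]
  exact mul_le_mul_of_nonneg_right (norm_I_mul_sub_one_pow_le n s) (Real.exp_nonneg _)

theorem integrable_airyMoment (n : ℕ) (x : ℝ) :
    Integrable fun s : ℝ => (Complex.I * s - 1) ^ n * airyKernel x s := by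
  have := continuous_airyKernel x
  exact (((integrable_exp_neg_mul_sq (by norm_num : (0 : ℝ) < 1 / 2)).const_mul _).mul_const _).mono'
    (Continuous.aestronglyMeasurable (by fun_prop)) (ae_of_all _ fun s => norm_airyMoment_le n x s)

/-- The `n`-th derivative of the (rescaled) Airy function. -/
noncomputable def airyMoment (n : ℕ) (x : ℝ) : ℂ :=
  ∫ s : ℝ, (Complex.I * s - 1) ^ n * airyKernel x s

theorem hasDerivAt_airyMoment (n : ℕ) (x : ℝ) :
    HasDerivAt (airyMoment n) (airyMoment (n + 1) x) x := by
  refine (hasDerivAt_integral_of_dominated_loc_of_deriv_le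
    (F := fun x (s : ℝ) => (Complex.I * s - 1) ^ n * airyKernel x s)
    (F' := fun x (s : ℝ) => (Complex.I * s - 1) ^ (n + 1) * airyKernel x s)
    (bound := fun s => (2 ^ (n + 1) * (n + 1).factorial * Real.exp (1 / 2)) *
      Real.exp (-(1 / 2) * s ^ 2) * Real.exp (-(x - 1)))
    (Metric.ball_mem_nhds x one_pos)
    (Eventually.of_forall fun y => (integrable_airyMoment n y).aestronglyMeasurable)
    (integrable_airyMoment n x) (integrable_airyMoment (n + 1) x).aestronglyMeasurable
    (ae_of_all _ fun s y hy => (norm_airyMoment_le (n + 1) y s).trans ?_)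
    (((integrable_exp_neg_mul_sq (by norm_num : (0 : ℝ) < 1 / 2)).const_mul _).mul_const _)
    (ae_of_all _ fun s y _ => ?_)).2
  · have : x - 1 ≤ y := by
      have := abs_lt.1 (Metric.mem_ball.1 hy : |y - x| < 1)
      linarith
    gcongr
  · have h1 : HasDerivAt (fun y : ℝ => -(s : ℂ) ^ 2 + Complex.I * ((s : ℂ) ^ 3 / 3 - s) +
        (Complex.I * s - 1) * (y : ℂ)) (Complex.I * s - 1) y := by
      simpa using ((hasDerivAt_id y).ofReal_comp.const_mul (Complex.I * s - 1)).const_add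
        (-(s : ℂ) ^ 2 + Complex.I * ((s : ℂ) ^ 3 / 3 - s))
    convert! h1.cexp.const_mul ((Complex.I * s - 1) ^ n) using 1
    simp only [airyKernel]; ring

/-- Airy's equation. -/
theorem airyMoment_two (x : ℝ) : airyMoment 2 x = x * airyMoment 0 x := by
  -- The s-derivative of the kernel is i(x - (is - 1)²) times the kernel; it integrates to zero, and
  -- that is Airy's equation.
  have hd : ∀ s : ℝ, HasDerivAt (airyKernel x)
      (Complex.I * (x * ((Complex.I * s - 1) ^ 0 * airyKernel x s) -
        (Complex.I * s - 1) ^ 2 * airyKernel x s)) s := fun s => by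
    have h0 := (hasDerivAt_id s).ofReal_comp
    have h1 : HasDerivAt (fun s : ℝ => -(s : ℂ) ^ 2 + Complex.I * ((s : ℂ) ^ 3 / 3 - s) +
        (Complex.I * s - 1) * (x : ℂ))
        (-(2 * s) + Complex.I * (s ^ 2 - 1) + Complex.I * x) s := by
      convert! ((h0.pow 2).neg.add ((((h0.pow 3).div_const 3).sub h0).const_mul Complex.I)).add
        (((h0.const_mul Complex.I).sub_const 1).mul_const (x : ℂ)) using 1
      simp
    convert! h1.cexp using 1
    simp only [airyKernel]
    linear_combination (-(Complex.I * s ^ 2) + 2 * s) *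
      Complex.exp (-(s : ℂ) ^ 2 + Complex.I * ((s : ℂ) ^ 3 / 3 - s) + (Complex.I * s - 1) * x) *
      Complex.I_sq
  have h := integral_eq_zero_of_hasDerivAt_of_integrable hd
    ((((integrable_airyMoment 0 x).const_mul _).sub (integrable_airyMoment 2 x)).const_mul _)
    (by simpa using integrable_airyMoment 0 x)
  rw [integral_const_mul, integral_sub ((integrable_airyMoment 0 x).const_mul _)
    (integrable_airyMoment 2 x), integral_const_mul] at h
  have := (mul_eq_zero.1 h).resolve_left Complex.I_ne_zero
  exact (sub_eq_zero.1 this).symm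

theorem norm_airyMoment_zero_le (x : ℝ) :
    ‖airyMoment 0 x‖ ≤ (∫ s, ‖airyKernel 0 s‖) * Real.exp (-x) := by
  refine (norm_integral_le_integral_norm _).trans_eq ?_
  rw [← integral_mul_const]
  congr 1 with s
  rw [pow_zero, one_mul, norm_airyKernel, norm_airyKernel, ← Real.exp_add]
  congr 1; ring

/-- Up to a nonvanishing exponential factor, the function at -2πξ is the Fourier transform at ξ of
the kernel for x = 0. Were it identically zero, inversion would kill an exponential. -/
theorem exists_airyMoment_ne_zero : ∃ x, airyMoment 0 x ≠ 0 := by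
  by_contra! h0
  have hF : FourierTransform.fourier (airyKernel 0) = 0 := by
    ext ξ
    rw [Real.fourier_eq']
    have : ∀ s : ℝ, Complex.exp (((-2 * Real.pi * inner ℝ s ξ : ℝ) : ℂ) * Complex.I) • airyKernel 0 s =
        Complex.exp ((-2 * Real.pi * ξ : ℝ)) *
          ((Complex.I * s - 1) ^ 0 * airyKernel (-2 * Real.pi * ξ) s) := fun s => by
      simp only [airyKernel, smul_eq_mul, pow_zero, one_mul, ← Complex.exp_add]
      congr 1
      simp
      ring
    simp only [this]
    rw [integral_const_mul]
    have h1 := h0 (-2 * Real.pi * ξ)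
    rw [airyMoment] at h1
    rw [h1, mul_zero, Pi.zero_apply]
  have hi : Integrable (airyKernel 0) := by simpa using integrable_airyMoment 0 0
  have := (continuous_airyKernel 0).fourierInv_fourier_eq hi (by rw [hF]; exact integrable_zero _ _ _)
  rw [hF] at this
  have h1 := congrFun this 0
  rw [Real.fourierInv_eq'] at h1
  simp [airyKernel] at h1

/-- There is a nonzero real solution of Airy's equation that decays exponentially at `+∞`. -/
theorem exists_airy : ∃ y y' : ℝ → ℝ, (∀ x, HasDerivAt y (y' x) x) ∧
    (∀ x, HasDerivAt y' (x * y x) x) ∧ (∃ C, ∀ x, |y x| ≤ C * Real.exp (-x)) ∧ ∃ x, y x ≠ 0 := by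
  obtain ⟨x, hx⟩ := exists_airyMoment_ne_zero
  have hd2 : ∀ x, HasDerivAt (airyMoment 1) (x * airyMoment 0 x) x := fun x => by
    rw [← airyMoment_two]; exact hasDerivAt_airyMoment 1 x
  by_cases hre : (airyMoment 0 x).re = 0
  · refine ⟨_, _, fun x => hasDerivAt_im (hasDerivAt_airyMoment 0 x), fun x => ?_,
      ⟨_, fun x => (Complex.abs_im_le_norm _).trans (norm_airyMoment_zero_le x)⟩, x, fun him => ?_⟩
    · have := hasDerivAt_im (hd2 x)
      rwa [Complex.im_ofReal_mul] at this
    · exact hx (Complex.ext hre him)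
  · refine ⟨_, _, fun x => hasDerivAt_re (hasDerivAt_airyMoment 0 x), fun x => ?_,
      ⟨_, fun x => (Complex.abs_re_le_norm _).trans (norm_airyMoment_zero_le x)⟩, x, hre⟩
    have := hasDerivAt_re (hd2 x)
    rwa [Complex.re_ofReal_mul] at this

/-! ### Oscillation at -∞ and large eigenvalues. -/

/-- A solution of Airy's equation is not positive near `-∞`. -/
theorem not_airy_pos {y y' : ℝ → ℝ} (hy : ∀ x, HasDerivAt y (y' x) x)
    (hy' : ∀ x, HasDerivAt y' (x * y x) x) {N : ℝ} (hN : 1 ≤ N) : ¬ ∀ x ≤ -N, 0 < y x := by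
  intro hpos
  have cy := continuous_of_hasDerivAt hy
  have cy' := continuous_of_hasDerivAt hy'
  have hint : ∀ x, y (-N) - y x = ∫ t in x..(-N), y' t := fun x =>
    (intervalIntegral.integral_eq_sub_of_hasDerivAt (fun t _ => hy t)
      (cy'.intervalIntegrable _ _)).symm
  have hanti : ∀ s t, s ≤ t → t ≤ -N → y' t ≤ y' s := fun s t hst ht => by
    have h1 : y' t - y' s = ∫ r in s..t, r * y r :=
      (intervalIntegral.integral_eq_sub_of_hasDerivAt (fun t _ => hy' t)
        (Continuous.intervalIntegrable (by fun_prop) _ _)).symm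
    have h2 : ∫ r in s..t, r * y r ≤ ∫ r in s..t, (0 : ℝ) :=
      intervalIntegral.integral_mono_on hst (Continuous.intervalIntegrable (by fun_prop) _ _)
        (Continuous.intervalIntegrable (by fun_prop) _ _) fun r hr =>
          mul_nonpos_of_nonpos_of_nonneg (by linarith [hr.2]) (hpos r (by linarith [hr.2])).le
    simp at h2
    linarith
  -- By concavity, a positive slope at x₁ would drive y below zero further left; the x chosen inside
  -- is one unit beyond the zero of the tangent.
  have hlin : ∀ x₁ ≤ -N, y' x₁ ≤ 0 := by
    intro x₁ hx₁
    by_contra! hm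
    set x := x₁ - y x₁ / y' x₁ - 1 with hx
    have hq : 0 < y x₁ / y' x₁ := div_pos (hpos x₁ hx₁) hm
    have hxx : x ≤ x₁ := by linarith
    have h1 : y x₁ - y x = ∫ t in x..x₁, y' t :=
      (intervalIntegral.integral_eq_sub_of_hasDerivAt (fun t _ => hy t)
        (cy'.intervalIntegrable _ _)).symm
    have h2 : ∫ t in x..x₁, y' x₁ ≤ ∫ t in x..x₁, y' t :=
      intervalIntegral.integral_mono_on hxx (Continuous.intervalIntegrable (by fun_prop) _ _)
        (cy'.intervalIntegrable _ _) fun r hr => hanti r x₁ hr.2 hx₁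
    rw [intervalIntegral.integral_const, smul_eq_mul] at h2
    have h3 : (x₁ - x) * y' x₁ = y x₁ + y' x₁ := by
      rw [hx]; field_simp; ring
    linarith [hpos x (by linarith)]
  have hge : ∀ x ≤ -N, y (-N) ≤ y x := fun x hx => by
    have h2 : ∫ t in x..(-N), y' t ≤ ∫ t in x..(-N), (0 : ℝ) :=
      intervalIntegral.integral_mono_on hx (cy'.intervalIntegrable _ _)
        (Continuous.intervalIntegrable (by fun_prop) _ _) fun r hr => hlin r hr.2
    simp at h2
    linarith [hint x]
  have hc := hpos (-N) le_rfl
  -- To the left of -N one has y'' ≤ -y(-N) since N ≥ 1, so over this distance the slope, followed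
  -- leftwards, rises by at least |y'(-N)| + 1 and becomes positive, against `hlin`.
  set x := -N - (|y' (-N)| + 1) / y (-N) with hx
  have hq : 0 < (|y' (-N)| + 1) / y (-N) := by positivity
  have hxN : x ≤ -N := by linarith
  have h1 : y' (-N) - y' x = ∫ r in x..(-N), r * y r :=
    (intervalIntegral.integral_eq_sub_of_hasDerivAt (fun t _ => hy' t)
      (Continuous.intervalIntegrable (by fun_prop) _ _)).symm
  have h2 : ∫ r in x..(-N), r * y r ≤ ∫ r in x..(-N), -y (-N) :=
    intervalIntegral.integral_mono_on hxN (Continuous.intervalIntegrable (by fun_prop) _ _)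
      (Continuous.intervalIntegrable (by fun_prop) _ _) fun r hr => by
        have := hge r hr.2
        nlinarith [hr.2]
  rw [intervalIntegral.integral_const, smul_eq_mul] at h2
  have h3 : (-N - x) * -y (-N) = -(|y' (-N)| + 1) := by
    rw [hx]; field_simp; ring
  linarith [hlin x hxN, neg_abs_le (y' (-N))]

/-- Neither y nor -y stays positive to the left of -N, so the intermediate value theorem applies. -/
theorem exists_airy_zero_le {y y' : ℝ → ℝ} (hy : ∀ x, HasDerivAt y (y' x) x)
    (hy' : ∀ x, HasDerivAt y' (x * y x) x) (N : ℝ) : ∃ a ≤ -N, y a = 0 := by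
  wlog hN : 1 ≤ N generalizing N
  · obtain ⟨a, ha, h0⟩ := this 1 le_rfl
    exact ⟨a, by linarith, h0⟩
  have cy := continuous_of_hasDerivAt hy
  have h1 := not_airy_pos hy hy' hN
  have h2 := not_airy_pos (y := fun x => -y x) (fun x => (hy x).neg)
    (fun x => by convert! (hy' x).neg using 1; ring) hN
  push Not at h1 h2
  obtain ⟨s, hs, hs0⟩ := h1
  obtain ⟨t, ht, ht0⟩ := h2
  obtain ⟨a, ha, ha0⟩ := intermediate_value_uIcc (a := s) (b := t) cy.continuousOn
    (Set.mem_uIcc.2 (Or.inl ⟨hs0, by linarith⟩))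
  refine ⟨a, ?_, ha0⟩
  exact ha.2.trans (sup_le hs ht)

/-- There are arbitrarily large eigenvalues. -/
theorem exists_isEigenvalue_gt (L : ℝ) : ∃ mu, L < mu ∧ IsEigenvalue mu := by
  obtain ⟨y, y', hy, hy', ⟨C, hC⟩, x₁, hx₁⟩ := exists_airy
  have cy := continuous_of_hasDerivAt hy
  have cy' := continuous_of_hasDerivAt hy'
  -- The bound |x₁| places a to the left of x₁, so the reflected function is nonzero at x₁ - a ≥ 0.
  obtain ⟨a, ha, ha0⟩ := exists_airy_zero_le hy hy' (max (L + 1) (|x₁|))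
  have haL : L < -a := by linarith [le_max_left (L + 1) |x₁|]
  have hax : a ≤ x₁ := by linarith [le_max_right (L + 1) |x₁|, neg_abs_le x₁]
  -- The eigenfunction is the odd extension of y(x + a), which vanishes at 0. Building it as the
  -- primitive of the even continuous V gives C¹ regularity across 0 at once.
  set V : ℝ → ℝ := fun t => y' (|t| + a) with hV
  have cV : Continuous V := by fun_prop
  set U : ℝ → ℝ := fun x => ∫ t in (0 : ℝ)..x, V t with hU
  have hUd : ∀ x, HasDerivAt U (V x) x := fun x => (cV.integral_hasStrictDerivAt 0 x).hasDerivAt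
  have cU := continuous_of_hasDerivAt hUd
  have hUpos : ∀ x, 0 ≤ x → U x = y (x + a) := fun x hx => by
    have h1 : ∫ t in (0 : ℝ)..x, V t = ∫ t in (0 : ℝ)..x, y' (t + a) := by
      refine intervalIntegral.integral_congr fun t ht => ?_
      rw [Set.uIcc_of_le hx] at ht
      simp only [hV, abs_of_nonneg ht.1]
    simp only [hU]
    rw [h1, intervalIntegral.integral_eq_sub_of_hasDerivAt
      (fun t _ => (hy (t + a)).comp_add_const t a)
      (Continuous.intervalIntegrable (by fun_prop) _ _)]
    simp [ha0]
  have hUodd : ∀ x, U (-x) = -U x := fun x => by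
    have h1 := intervalIntegral.integral_comp_neg (a := 0) (b := x) V
    have h2 : (fun t => V (-t)) = V := by ext t; simp [hV]
    simp only [h2, neg_zero] at h1
    simp only [hU]
    rw [h1, intervalIntegral.integral_symm]
  have hVd : ∀ x, HasDerivAt V ((|x| + a) * U x) x := by
    have hne : ∀ x, x ≠ 0 → HasDerivAt V ((|x| + a) * U x) x := by
      intro x hx
      rcases hx.lt_or_gt with h | h
      · have h1 := (hy' (|x| + a)).comp x ((hasDerivAt_abs_neg h).add_const a)
        convert! h1 using 1
        rw [show U x = -U (-x) by rw [hUodd]; ring, hUpos (-x) (by linarith), abs_of_neg h]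
        ring
      · have h1 := (hy' (|x| + a)).comp x ((hasDerivAt_abs_pos h).add_const a)
        convert! h1 using 1
        rw [hUpos x h.le, abs_of_pos h]
        ring
    intro x
    by_cases hx : x = 0
    · subst hx
      exact hasDerivAt_of_hasDerivAt_of_ne hne cV.continuousAt
        (Continuous.continuousAt (by fun_prop))
    · exact hne x hx
  have hUabs : ∀ x, |U x| ≤ (C * Real.exp (-a)) * Real.exp (-|x|) := by
    have hp : ∀ x, 0 ≤ x → |U x| ≤ (C * Real.exp (-a)) * Real.exp (-|x|) := fun x hx => by
      rw [hUpos x hx, abs_of_nonneg hx, mul_assoc, ← Real.exp_add]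
      convert hC (x + a) using 3
      ring
    intro x
    rcases le_total 0 x with h | h
    · exact hp x h
    · have := hp (-x) (by linarith)
      rwa [hUodd, abs_neg, abs_neg] at this
  set u : ℝ → ℂ := fun x => (U x : ℂ) with hu
  have hud : ∀ x, HasDerivAt u (V x : ℂ) x := fun x => (hUd x).ofReal_comp
  have hdu : deriv u = fun x => (V x : ℂ) := funext fun x => (hud x).deriv
  have hvd : ∀ x, HasDerivAt (deriv u) (((|x| + a) * U x : ℝ) : ℂ) x := fun x => by
    rw [hdu]; exact (hVd x).ofReal_comp
  have hH : H u = fun x => ((-a : ℝ) : ℂ) * u x := by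
    ext x
    rw [H, (hvd x).deriv]
    simp only [hu]
    push_cast; ring
  have hL2 : MemLp u 2 volume := by
    have cu : Continuous u := by fun_prop
    rw [memLp_two_iff_integrable_sq_norm cu.aestronglyMeasurable]
    refine (integrable_inv_one_add_sq.const_mul ((C * Real.exp (-a)) ^ 2)).mono'
      (Continuous.aestronglyMeasurable (by fun_prop)) (ae_of_all _ fun x => ?_)
    rw [Real.norm_of_nonneg (sq_nonneg _)]
    simp only [hu, Complex.norm_real, Real.norm_eq_abs]
    have h1 := pow_le_pow_left₀ (abs_nonneg _) (hUabs x) 2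
    rw [mul_pow] at h1
    refine h1.trans (mul_le_mul_of_nonneg_left ?_ (sq_nonneg _))
    rw [Real.exp_neg, inv_pow]
    refine inv_anti₀ (by positivity) ?_
    have h2 := Real.add_one_le_exp |x|
    have h3 := abs_nonneg x
    nlinarith [sq_abs x]
  refine ⟨-a, haL, u, ⟨hL2, fun x => (hud x).differentiableAt, fun b c =>
    absolutelyContinuousOnInterval_of_hasDerivAt hvd (by fun_prop) b c, ?_⟩, fun h0 => ?_, ?_⟩
  · rw [hH]; exact hL2.const_mul _
  · have h1 := congrFun h0 (x₁ - a)
    simp only [hu, Pi.zero_apply, Complex.ofReal_eq_zero] at h1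
    rw [hUpos _ (by linarith), sub_add_cancel] at h1
    exact hx₁ h1
  · rw [hH]; exact ae_of_all _ fun x => rfl

/-! ### Discreteness and enumeration of the eigenvalues. -/

theorem isLeast_sInf_of_finite {A : Set ℝ} (hne : A.Nonempty)
    (hfin : ∀ L, (A ∩ Set.Iic L).Finite) : IsLeast A (sInf A) := by
  obtain ⟨x, hx⟩ := hne
  obtain ⟨m, ⟨hmA, hmx⟩, hm⟩ := Set.exists_min_image _ id (hfin x) ⟨x, hx, Set.self_mem_Iic⟩
  have : IsLeast A m := ⟨hmA, fun z hz => by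
    rcases le_total z x with h | h
    · exact hm z ⟨hz, h⟩
    · exact le_trans hmx h⟩
  rwa [this.csInf_eq]

theorem IsEigenvalue.exists_normalized {mu : ℝ} (h : IsEigenvalue mu) :
    ∃ u, IsClassicalEigenfunction mu u ∧ ∫ x, ‖u x‖ ^ 2 = 1 := by
  obtain ⟨u, hu, hne, he⟩ := h
  have hc : IsClassicalEigenfunction mu u := ⟨hu.isSolution he, hu.memLp⟩
  have hpos : 0 < ∫ x, ‖u x‖ ^ 2 := by
    simpa using hc.setIntegral_pos hne (E := Set.univ) (by simp)
  set r := Real.sqrt (∫ x, ‖u x‖ ^ 2) with hr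
  have hr0 : 0 < r := Real.sqrt_pos.2 hpos
  have h2 : IsClassicalEigenfunction mu fun x => u x - (1 - (r : ℂ)⁻¹) * u x :=
    hc.sub_const_mul hc _
  refine ⟨_, h2, ?_⟩
  have e : ∀ x, ‖u x - (1 - (r : ℂ)⁻¹) * u x‖ ^ 2 = (r ^ 2)⁻¹ * ‖u x‖ ^ 2 := fun x => by
    rw [show u x - (1 - (r : ℂ)⁻¹) * u x = (r : ℂ)⁻¹ * u x by ring, norm_mul, mul_pow, norm_inv,
      Complex.norm_real, Real.norm_eq_abs, inv_pow, sq_abs]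
  simp only [e]
  rw [integral_const_mul, hr, Real.sq_sqrt hpos.le, inv_mul_cancel₀ hpos.ne']

/-- Bessel's inequality and the sup bound control the diagonal of the spectral kernel. -/
theorem sum_norm_sq_le {T : Finset ℝ} {φ : ℝ → ℝ → ℂ} {L : ℝ}
    (h : ∀ mu ∈ T, IsClassicalEigenfunction mu (φ mu)) (hn : ∀ mu ∈ T, ∫ x, ‖φ mu x‖ ^ 2 = 1)
    (hL : ∀ mu ∈ T, |mu| ≤ L) (x : ℝ) : ∑ mu ∈ T, ‖φ mu x‖ ^ 2 ≤ 60 + 8 * L ^ 2 := by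
  set s := ∑ mu ∈ T, ‖φ mu x‖ ^ 2 with hs
  set c : ℝ → ℂ := fun mu => (starRingEnd ℂ) (φ mu x) with hc
  have hs0 : 0 ≤ s := Finset.sum_nonneg fun _ _ => sq_nonneg _
  have hcs : ∑ mu ∈ T, ‖c mu‖ ^ 2 = s := by simp [hc, hs]
  have hux : ‖∑ mu ∈ T, c mu * φ mu x‖ = s := by
    have : ∑ mu ∈ T, c mu * φ mu x = (s : ℂ) := by
      rw [hs]; push_cast
      exact Finset.sum_congr rfl fun mu _ => Complex.conj_mul' _
    rw [this, Complex.norm_real, Real.norm_of_nonneg hs0]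
  -- With coefficients conj φ_mu(x), the combination equals s at x and has squared norm s. The sup
  -- bound at lam = 0 then reads s² ≤ (60 + 8L²)s.
  have hsol := isSolution_sum T h c 0
  have key := hsol.norm_sq_le_unit_window (a := x) (y := x) ⟨le_rfl, by linarith⟩
  have hU := intervalIntegral_le_integral (integrable_norm_sq_sum T h c)
    (fun x => sq_nonneg _) (by linarith : x - 1 ≤ x + 2)
  have hF := intervalIntegral_le_integral
    (integrable_norm_sq_sum T h fun mu => c mu * ((mu - 0 : ℝ) : ℂ))
    (fun x => sq_nonneg _) (by linarith : x - 1 ≤ x + 2)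
  have hinj : Set.InjOn (fun mu : ℝ => mu) T := fun _ _ _ _ e => e
  rw [integral_norm_sq_sum T h hn hinj] at hU hF
  rw [max_eq_left (by linarith [abs_nonneg x]), hux] at key
  have h3 : ∑ mu ∈ T, ‖c mu * ((mu - 0 : ℝ) : ℂ)‖ ^ 2 ≤ L ^ 2 * s := by
    rw [← hcs, Finset.mul_sum]
    refine Finset.sum_le_sum fun mu hmu => ?_
    rw [norm_mul, mul_pow, sub_zero, Complex.norm_real, Real.norm_eq_abs, mul_comm]
    exact mul_le_mul_of_nonneg_right (pow_le_pow_left₀ (abs_nonneg _) (hL mu hmu) 2) (sq_nonneg _)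
  rw [hcs] at hU
  rcases hs0.eq_or_lt with h0 | h0
  · rw [← h0]; positivity
  · refine le_of_mul_le_mul_right ?_ h0
    nlinarith

/-- Trace argument: each normalized eigenfunction has mass at least 1/2 on the same interval [-X,
X], while the sum of their squared moduli is bounded pointwise independently of how many there are.
-/
theorem finite_isEigenvalue_abs_le (L : ℝ) : {mu : ℝ | IsEigenvalue mu ∧ |mu| ≤ L}.Finite := by
  by_contra hinf
  rcases lt_or_ge L 0 with hL0 | hL0
  · exact hinf (Set.Finite.subset Set.finite_empty fun mu hmu =>
      absurd (hmu.2.trans_lt hL0) (not_lt.2 (abs_nonneg mu)))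
  have hch : ∀ mu : ℝ, ∃ u : ℝ → ℂ, IsEigenvalue mu →
      IsClassicalEigenfunction mu u ∧ ∫ x, ‖u x‖ ^ 2 = 1 := fun mu => by
    by_cases h : IsEigenvalue mu
    · obtain ⟨u, hu⟩ := h.exists_normalized
      exact ⟨u, fun _ => hu⟩
    · exact ⟨0, fun h' => absurd h' h⟩
  choose φ hφ using hch
  set X := 8 * L + 10 with hX
  obtain ⟨n, hn⟩ := exists_nat_gt (2 * (2 * X * (60 + 8 * L ^ 2)))
  obtain ⟨T, hT, hTn⟩ := Set.Infinite.exists_subset_card_eq hinf n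
  have h1 : ∀ mu ∈ T, IsClassicalEigenfunction mu (φ mu) := fun mu hmu => (hφ mu (hT hmu).1).1
  have h2 : ∀ mu ∈ T, ∫ x, ‖φ mu x‖ ^ 2 = 1 := fun mu hmu => (hφ mu (hT hmu).1).2
  have h3 : ∀ mu ∈ T, |mu| ≤ L := fun mu hmu => (hT hmu).2
  have h4 : (n : ℝ) * (1 / 2) ≤ ∑ mu ∈ T, ∫ x in Set.Icc (-X) X, ‖φ mu x‖ ^ 2 := by
    rw [← hTn, ← nsmul_eq_mul]
    exact Finset.card_nsmul_le_sum _ _ _ fun mu hmu =>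
      (h1 mu hmu).half_le_integral (h2 mu hmu) (h3 mu hmu) le_rfl
  rw [← integral_finsetSum _ fun mu hmu => (h1 mu hmu).integrable_norm_sq.integrableOn] at h4
  have h5 : ∫ x in Set.Icc (-X) X, ∑ mu ∈ T, ‖φ mu x‖ ^ 2 ≤
      ∫ x in Set.Icc (-X) X, (60 + 8 * L ^ 2) :=
    integral_mono (integrable_finsetSum _ fun mu hmu => (h1 mu hmu).integrable_norm_sq.integrableOn)
      (integrable_const _) fun x => sum_norm_sq_le h1 h2 h3 x
  rw [setIntegral_const, Real.volume_real_Icc_of_le (by linarith), smul_eq_mul] at h5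
  linarith

theorem finite_isEigenvalue_le (L : ℝ) : ({mu : ℝ | IsEigenvalue mu} ∩ Set.Iic L).Finite := by
  refine (finite_isEigenvalue_abs_le (max L 5)).subset fun mu hmu => ⟨hmu.1, ?_⟩
  obtain ⟨u, hu, hn⟩ := IsEigenvalue.exists_normalized hmu.1
  have := hu.neg_five_le hn
  have h2 : mu ≤ L := hmu.2
  rw [abs_le]
  constructor <;> linarith [le_max_left L 5, le_max_right L 5]

theorem isLeast_eigenvalueAux_succ (m : ℕ) :
    IsLeast {mu : ℝ | IsEigenvalue mu ∧ eigenvalueAux m < mu} (eigenvalueAux (m + 1)) := by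
  refine isLeast_sInf_of_finite ?_ fun L =>
    (finite_isEigenvalue_le L).subset fun mu hmu => ⟨hmu.1.1, hmu.2⟩
  obtain ⟨mu, h1, h2⟩ := exists_isEigenvalue_gt (eigenvalueAux m)
  exact ⟨mu, h2, h1⟩

theorem isEigenvalue_eigenvalueAux (m : ℕ) : IsEigenvalue (eigenvalueAux m) := by
  cases m with
  | zero =>
    obtain ⟨mu, -, h⟩ := exists_isEigenvalue_gt 0
    exact (isLeast_sInf_of_finite ⟨mu, h⟩ finite_isEigenvalue_le).1
  | succ m => exact (isLeast_eigenvalueAux_succ m).1.1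

theorem isEigenvalue_eigenvalue (k : ℕ+) : IsEigenvalue (eigenvalue k) :=
  isEigenvalue_eigenvalueAux _

theorem eigenvalue_injective : Function.Injective eigenvalue := by
  have h : StrictMono eigenvalueAux := strictMono_nat_of_lt_succ fun m =>
    (isLeast_eigenvalueAux_succ m).1.2
  exact h.injective.comp PNat.natPred_injective

theorem finite_eigenvalue_le (L : ℝ) : {k : ℕ+ | eigenvalue k ≤ L}.Finite :=
  ((finite_isEigenvalue_le L).preimage eigenvalue_injective.injOn).subset fun k hk =>
    ⟨isEigenvalue_eigenvalue k, hk⟩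

theorem finite_J (α ε lam : ℝ) : (J α ε lam).Finite :=
  (finite_eigenvalue_le (lam + windowWidth α ε lam)).subset fun k hk => by
    have h : |eigenvalue k - lam| < windowWidth α ε lam := hk
    have := (abs_lt.1 h).2
    show eigenvalue k ≤ _
    linarith

/-! ### Thin sets and summation over unit intervals. -/

theorem IsAlphaThin.exists_bound {α : ℝ} {S : Set ℝ} (h : IsAlphaThin α S) :
    ∃ C : ℝ, 0 < C ∧ ∃ R : ℝ, 1 ≤ R ∧ ∀ x : ℝ, R ≤ |x| →
      volume.real (S ∩ Set.Icc x (x + 1)) ≤ C * |x| ^ (-α) := by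
  obtain ⟨C, hC, hlim⟩ := h
  have h1 := eventually_lt_of_limsup_lt hlim
  rw [eventually_comap] at h1
  obtain ⟨R, hR⟩ := eventually_atTop.1 h1
  refine ⟨C, hC, max R 1, le_max_right _ _, fun x hx => ?_⟩
  have h2 := hR |x| ((le_max_left _ _).trans hx) x rfl
  have hx0 : 0 < |x| := by linarith [(le_max_right R 1).trans hx]
  have h3 := ENNReal.toReal_mono ENNReal.ofReal_ne_top h2.le
  rw [ENNReal.toReal_mul, ENNReal.toReal_ofReal (by positivity), ENNReal.toReal_ofReal hC.le] at h3
  rw [Real.rpow_neg hx0.le, ← div_eq_mul_inv, le_div_iff₀ (by positivity)]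
  exact h3

/-- If S were null, its complement would fill every unit interval, but thinness with α > 0 makes
that measure decay. -/
theorem IsAlphaThin.volume_compl_ne_zero {α : ℝ} (hα : 0 < α) {S : Set ℝ} (h : IsAlphaThin α Sᶜ) :
    volume S ≠ 0 := by
  intro h0
  obtain ⟨C, hC, R, hR, hb⟩ := h.exists_bound
  have h1 : ∀ x, R ≤ x → x ^ α ≤ C := fun x hx => by
    have hx0 : 0 < x := by linarith
    have h2 := hb x (by rwa [abs_of_pos hx0])
    have h3 : volume (Sᶜ ∩ Set.Icc x (x + 1)) = volume (Set.Icc x (x + 1)) := by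
      rw [Set.inter_comm, ← Set.sdiff_eq]
      exact measure_sdiff_null h0
    rw [measureReal_def, h3, ← measureReal_def, Real.volume_real_Icc_of_le (by linarith),
      abs_of_pos hx0, Real.rpow_neg hx0.le, ← div_eq_mul_inv, le_div_iff₀ (by positivity)] at h2
    linarith
  obtain ⟨x, hx⟩ := ((tendsto_rpow_atTop hα).eventually_gt_atTop C |>.and
    (eventually_ge_atTop R)).exists
  exact absurd (h1 x hx.2) (not_le.2 hx.1)

theorem intervalIntegral_indicator_le {S : Set ℝ} (hS : NullMeasurableSet S volume) {p : ℝ → ℝ}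
    (hp : ∀ x, 0 ≤ p x) {a K : ℝ} (hK : ∀ x ∈ Set.Icc a (a + 1), p x ≤ K) :
    ∫ x in a..(a + 1), S.indicator p x ≤ K * volume.real (S ∩ Set.Icc a (a + 1)) := by
  have hK0 : 0 ≤ K := (hp a).trans (hK a ⟨le_rfl, by linarith⟩)
  have hfin : volume (S ∩ Set.Icc a (a + 1)) < ⊤ :=
    (measure_mono Set.inter_subset_right).trans_lt measure_Icc_lt_top
  have hsub : S ∩ Set.Ioc a (a + 1) ⊆ S ∩ Set.Icc a (a + 1) :=
    Set.inter_subset_inter_right _ Set.Ioc_subset_Icc_self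
  have hS' : NullMeasurableSet S (volume.restrict (Set.Ioc a (a + 1))) :=
    hS.mono_ac Measure.absolutelyContinuous_restrict
  rw [intervalIntegral.integral_of_le (by linarith), integral_indicator₀ hS',
    Measure.restrict_restrict₀ hS']
  refine (Real.le_norm_self _).trans ((norm_setIntegral_le_of_norm_le_const (C := K)
    ((measure_mono hsub).trans_lt hfin) fun x hx => ?_).trans
    (mul_le_mul_of_nonneg_left (measureReal_mono hsub hfin.ne) hK0))
  rw [Real.norm_of_nonneg (hp x)]
  exact hK x (hsub hx).2

/-- Summation of local estimates over integer windows. -/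
theorem setIntegral_le_of_windows {S : Set ℝ} (hS : NullMeasurableSet S volume) {p q : ℝ → ℝ}
    (hp : Integrable p) (hq : Integrable q) {A B P : ℝ} {R : ℕ} (hA : 0 ≤ A) (hB : 0 ≤ B)
    (hP : 0 ≤ P) (hp0 : ∀ x, 0 ≤ p x) (hq0 : ∀ x, 0 ≤ q x)
    (hfar : ∀ a : ℤ, (R : ℝ) ≤ |(a : ℝ)| → ∫ x in (a : ℝ)..(a + 1), S.indicator p x ≤
      A * (∫ x in (a - 1 : ℝ)..(a + 2), p x) + B * ∫ x in (a - 1 : ℝ)..(a + 2), q x)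
    (hnear : ∀ a : ℤ, |(a : ℝ)| < R → ∫ x in (a : ℝ)..(a + 1), S.indicator p x ≤ P) :
    ∫ x in S, p x ≤ 3 * A * (∫ x, p x) + 3 * B * (∫ x, q x) + 2 * R * P := by
  have hwin : ∀ {g : ℝ → ℝ}, Integrable g →
      HasSum (fun a : ℤ => ∫ x in (a - 1 : ℝ)..(a + 2), g x) (3 * ∫ x, g x) := by
    intro g hg
    -- The enlarged windows cover the line three times: one tiling for each of the shifts -1, 0, 1.
    have h := ((hg.hasSum_intervalIntegral (-1)).add (hg.hasSum_intervalIntegral 0)).add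
      (hg.hasSum_intervalIntegral 1)
    convert! h using 1
    · ext a
      have hi : ∀ s t : ℝ, IntervalIntegrable g volume s t := fun s t => hg.intervalIntegrable
      rw [show (-1 + a : ℝ) = a - 1 by ring, show (a - 1 + 1 : ℝ) = a by ring, zero_add,
        show (1 + a : ℝ) = a + 1 by ring, show (a + 1 + 1 : ℝ) = a + 2 by ring,
        intervalIntegral.integral_add_adjacent_intervals (hi _ _) (hi _ _),
        intervalIntegral.integral_add_adjacent_intervals (hi _ _) (hi _ _)]
    · ring
  have hL := (hp.indicator₀ hS).hasSum_intervalIntegral 0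
  simp only [zero_add] at hL
  rw [integral_indicator₀ hS] at hL
  classical
  set F : Finset ℤ := Finset.Ioo (-(R : ℤ)) R with hF
  have hmem : ∀ a : ℤ, a ∈ F ↔ |(a : ℝ)| < R := fun a => by
    rw [hF, Finset.mem_Ioo, abs_lt]
    constructor
    · rintro ⟨h1, h2⟩
      exact ⟨by exact_mod_cast h1, by exact_mod_cast h2⟩
    · rintro ⟨h1, h2⟩
      exact ⟨by exact_mod_cast h1, by exact_mod_cast h2⟩
  have hN : HasSum (fun a : ℤ => if a ∈ F then P else 0) (∑ a ∈ F, if a ∈ F then P else 0) :=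
    hasSum_sum_of_ne_finset_zero fun a ha => if_neg ha
  have hR := (((hwin hp).mul_left A).add ((hwin hq).mul_left B)).add hN
  have key := hasSum_le (fun a : ℤ => ?_) hL hR
  · refine key.trans ?_
    have h1 : ∑ a ∈ F, (if a ∈ F then P else 0) ≤ 2 * R * P := by
      rw [Finset.sum_congr rfl fun a ha => if_pos ha, Finset.sum_const, nsmul_eq_mul, hF,
        Int.card_Ioo]
      refine mul_le_mul_of_nonneg_right ?_ hP
      have : ((R : ℤ) - -(R : ℤ) - 1).toNat ≤ 2 * R := by omega
      exact_mod_cast this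
    linarith
  · by_cases ha : a ∈ F
    · simp only [if_pos ha]
      have h1 : 0 ≤ ∫ x in (a - 1 : ℝ)..(a + 2), p x :=
        intervalIntegral.integral_nonneg (by linarith) fun x _ => hp0 x
      have h2 : 0 ≤ ∫ x in (a - 1 : ℝ)..(a + 2), q x :=
        intervalIntegral.integral_nonneg (by linarith) fun x _ => hq0 x
      linarith [hnear a ((hmem a).1 ha), mul_nonneg hA h1, mul_nonneg hB h2]
    · simp only [if_neg ha, add_zero]
      exact hfar a (not_lt.1 fun h => ha ((hmem a).2 h))

/-! ### Window width against the weight of f. -/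

theorem windowWidth_eq_mul (α ε lam : ℝ) : windowWidth α ε lam = ε * windowWidth α 1 lam := by
  unfold windowWidth
  split_ifs <;> ring

/-- The only size bounds on the window that the high-frequency estimate uses. Taking lam ≥ e makes
the logarithm at least 1. -/
theorem windowWidth_one_sq_le {α lam : ℝ} (hlam : Real.exp 1 ≤ lam) :
    windowWidth α 1 lam ^ 2 ≤ lam ∧ windowWidth α 1 lam ^ 2 ≤ lam ^ α := by
  have h1 : 1 ≤ lam := le_trans (by linarith [Real.add_one_le_exp 1]) hlam
  have h0 : 0 < lam := by linarith
  have hhalf : (lam ^ (1 / 2 : ℝ)) ^ 2 = lam := by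
    rw [← Real.sqrt_eq_rpow, Real.sq_sqrt h0.le]
  have hmono : 1 ≤ α → lam ≤ lam ^ α := fun h => by
    simpa using Real.rpow_le_rpow_of_exponent_le h1 h
  unfold windowWidth
  split_ifs with h2 h3
  · have e : (1 * lam ^ (α - 1 / 2)) ^ 2 = lam ^ (2 * α - 1) := by
      rw [one_mul, ← Real.rpow_natCast, ← Real.rpow_mul h0.le]
      congr 1; push_cast; ring
    rw [e]
    refine ⟨?_, Real.rpow_le_rpow_of_exponent_le h1 (by linarith)⟩
    simpa using Real.rpow_le_rpow_of_exponent_le h1 (by linarith : 2 * α - 1 ≤ 1)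
  · have hlog : 1 ≤ Real.log lam := by rwa [Real.le_log_iff_exp_le h0]
    have hle : (1 * lam ^ (1 / 2 : ℝ) * (Real.log lam)⁻¹) ^ 2 ≤ lam := by
      rw [one_mul, mul_pow, hhalf]
      exact mul_le_of_le_one_right h0.le (pow_le_one₀ (by positivity) (inv_le_one_of_one_le₀ hlog))
    exact ⟨hle, hle.trans (hmono h3.ge)⟩
  · rw [one_mul, hhalf]
    exact ⟨le_rfl, hmono (not_lt.1 h2)⟩

theorem mul_windowWidth_one_sq_le {α lam K Y : ℝ} (hlam : Real.exp 1 ≤ lam) (hK : 0 ≤ K)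
    (hY : 0 ≤ Y) :
    (K * (2 / lam + 2 ^ α * lam ^ (-α)) + Y / lam) * windowWidth α 1 lam ^ 2 ≤
      K * (2 + 2 ^ α) + Y := by
  obtain ⟨w1, w2⟩ := windowWidth_one_sq_le (α := α) hlam
  have hlam0 : 0 < lam := (Real.exp_pos 1).trans_le hlam
  set W := windowWidth α 1 lam ^ 2
  have a1 : W / lam ≤ 1 := (div_le_one hlam0).2 w1
  have a2 : lam ^ (-α) * W ≤ 1 := by
    rw [Real.rpow_neg hlam0.le, inv_mul_le_iff₀ (by positivity), mul_one]
    exact w2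
  have a3 : (0 : ℝ) < 2 ^ α := by positivity
  calc (K * (2 / lam + 2 ^ α * lam ^ (-α)) + Y / lam) * W
      = K * (2 * (W / lam) + 2 ^ α * (lam ^ (-α) * W)) + Y * (W / lam) := by ring
    _ ≤ K * (2 * 1 + 2 ^ α * 1) + Y * 1 := by gcongr
    _ = _ := by ring

theorem sq_mul_le_of_le_one_div {ε M : ℝ} (hε : 0 < ε) (hM : 1 ≤ M) (h : ε ≤ 1 / (4 * M)) :
    ε ^ 2 * M ≤ 1 / 4 := by
  rw [le_div_iff₀ (by positivity)] at h
  have : ε ≤ 1 := by nlinarith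
  nlinarith

/-- The weight of a far window. -/
theorem rpow_neg_div_max_le {α lam R t : ℝ} (hα : 0 ≤ α) (hR : 1 ≤ R) (ht : R ≤ t) (hlam : 1 ≤ lam) :
    t ^ (-α) / max 1 (lam - t) ≤ 2 / lam + 2 ^ α * lam ^ (-α) := by
  have ht0 : 0 < t := by linarith
  have hlam0 : 0 < lam := by linarith
  have hp : 0 < 2 ^ α * lam ^ (-α) := by positivity
  have hq : 0 < 2 / lam := by positivity
  -- Deep in the allowed region lam - t ≥ lam/2 is enough without thinness; beyond it, thinness
  -- alone yields lam^(-α).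
  rcases le_total t (lam / 2) with h | h
  · have h1 : t ^ (-α) ≤ 1 := Real.rpow_le_one_of_one_le_of_nonpos (hR.trans ht) (by linarith)
    have h2 : t ^ (-α) / max 1 (lam - t) ≤ 1 / (lam / 2) :=
      div_le_div₀ zero_le_one h1 (by positivity) ((by linarith : lam / 2 ≤ lam - t).trans
        (le_max_right _ _))
    rw [one_div_div] at h2
    linarith
  · have h1 : t ^ (-α) / max 1 (lam - t) ≤ t ^ (-α) :=
      div_le_self (by positivity) (le_max_left _ _)
    have h2 : t ^ (-α) ≤ (lam / 2) ^ (-α) :=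
      Real.rpow_le_rpow_of_nonpos (by positivity) h (by linarith)
    have h3 : (lam / 2) ^ (-α) = 2 ^ α * lam ^ (-α) := by
      rw [Real.div_rpow hlam0.le zero_le_two, Real.rpow_neg zero_le_two]
      field_simp
    linarith

/-! ### High-frequency estimate and conclusion. -/

/-- The resolvent estimate at high frequency: functions in a narrow spectral window have little
mass on a thin set. -/
theorem exists_resolvent_estimate {α : ℝ} (hα : 1 / 2 ≤ α) {S : Set ℝ}
    (hS : NullMeasurableSet S volume) (hthin : IsAlphaThin α S) :
    ∃ ε₀ : ℝ, 0 < ε₀ ∧ ∃ L : ℝ, ∀ ε lam : ℝ, 0 < ε → ε ≤ ε₀ → L ≤ lam →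
      ∀ u v f : ℝ → ℂ, IsSolution lam u v f → Integrable (fun x => ‖u x‖ ^ 2) →
        Integrable (fun x => ‖f x‖ ^ 2) →
        ∫ x, ‖f x‖ ^ 2 ≤ windowWidth α ε lam ^ 2 * ∫ x, ‖u x‖ ^ 2 →
        ∫ x in S, ‖u x‖ ^ 2 ≤ 1 / 2 * ∫ x, ‖u x‖ ^ 2 := by
  obtain ⟨C, hC, R₀, hR₀, hb⟩ := hthin.exists_bound
  have hα0 : 0 < α := by linarith
  -- Budget: 1/8 from the far u-term (180 = 3·60), 1/8 from the core u-term, 1/4 from all f-terms.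
  obtain ⟨R, hRR₀, hRC⟩ : ∃ R : ℕ, R₀ ≤ R ∧ 180 * C * (R : ℝ) ^ (-α) ≤ 1 / 8 := by
    have h1 : Tendsto (fun R : ℕ => 180 * C * (R : ℝ) ^ (-α)) atTop (nhds (180 * C * 0)) :=
      ((tendsto_rpow_neg_atTop hα0).comp tendsto_natCast_atTop_atTop).const_mul _
    rw [mul_zero] at h1
    exact ((tendsto_natCast_atTop_atTop.eventually_ge_atTop R₀).and
      (h1.eventually_le_const (by norm_num))).exists
  have hR1 : (1 : ℝ) ≤ R := hR₀.trans hRR₀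
  -- Makes 2R·9/ℓ ≤ 1/8, and the core lies within |x| ≤ ℓ/2.
  set ℓ : ℝ := 144 * (R + 1) with hℓ
  have hℓ1 : 1 ≤ ℓ := by linarith
  set M : ℝ := 24 * C * (2 + 2 ^ α) + 16 * R * ℓ with hM
  have hM1 : 1 ≤ M := by
    have : 0 ≤ 24 * C * (2 + (2 : ℝ) ^ α) := by positivity
    nlinarith
  refine ⟨1 / (4 * M), by positivity, max (Real.exp 1) (100 * ℓ ^ 4), ?_⟩
  intro ε lam hε hεM hlam u v f hsol hu hf hfu
  have hlam1 : Real.exp 1 ≤ lam := (le_max_left _ _).trans hlam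
  have hlam2 : 100 * ℓ ^ 4 ≤ lam := (le_max_right _ _).trans hlam
  have h1lam : 1 ≤ lam := le_trans (by linarith [Real.add_one_le_exp 1]) hlam1
  have hlam0 : 0 < lam := by linarith
  set Nu := ∫ x, ‖u x‖ ^ 2 with hNu
  set Nf := ∫ x, ‖f x‖ ^ 2 with hNf
  have hNu0 : 0 ≤ Nu := integral_nonneg fun x => sq_nonneg _
  have hNf0 : 0 ≤ Nf := integral_nonneg fun x => sq_nonneg _
  set Q := 2 / lam + 2 ^ α * lam ^ (-α) with hQ
  have hQ0 : 0 ≤ Q := by positivity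
  have hRα : 0 ≤ (R : ℝ) ^ (-α) := by positivity
  have key : ∫ x in S, ‖u x‖ ^ 2 ≤ 3 * (60 * (C * (R : ℝ) ^ (-α))) * Nu + 3 * (8 * (C * Q)) * Nf +
      2 * R * (9 / ℓ * Nu + 8 * ℓ / lam * Nf) := by
    refine setIntegral_le_of_windows hS hu hf (by positivity) (by positivity) (by positivity)
      (fun x => sq_nonneg _) (fun x => sq_nonneg _) ?_ ?_
    · intro a ha
      have ha1 : R₀ ≤ |(a : ℝ)| := hRR₀.trans ha
      have ha0 : 0 < |(a : ℝ)| := by linarith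
      set Iu := ∫ x in (a - 1 : ℝ)..(a + 2), ‖u x‖ ^ 2 with hIu
      set If := ∫ x in (a - 1 : ℝ)..(a + 2), ‖f x‖ ^ 2 with hIf
      have hIu0 : 0 ≤ Iu := intervalIntegral.integral_nonneg (by linarith) fun x _ => sq_nonneg _
      have hIf0 : 0 ≤ If := intervalIntegral.integral_nonneg (by linarith) fun x _ => sq_nonneg _
      refine (intervalIntegral_indicator_le hS (fun x => sq_nonneg _)
        fun x hx => hsol.norm_sq_le_unit_window hx).trans ?_
      have hK0 : 0 ≤ 60 * Iu + 8 / max 1 (lam - |(a : ℝ)|) * If := by positivity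
      refine (mul_le_mul_of_nonneg_left (hb a ha1) hK0).trans ?_
      have h1 : |(a : ℝ)| ^ (-α) ≤ (R : ℝ) ^ (-α) :=
        Real.rpow_le_rpow_of_nonpos (by linarith) ha (by linarith)
      have h2 := rpow_neg_div_max_le hα0.le hR1 ha h1lam
      have h3 : (60 * Iu + 8 / max 1 (lam - |(a : ℝ)|) * If) * (C * |(a : ℝ)| ^ (-α)) =
          60 * (C * |(a : ℝ)| ^ (-α)) * Iu +
            8 * (C * (|(a : ℝ)| ^ (-α) / max 1 (lam - |(a : ℝ)|))) * If := by ring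
      rw [h3]
      exact add_le_add
        (mul_le_mul_of_nonneg_right (mul_le_mul_of_nonneg_left
          (mul_le_mul_of_nonneg_left h1 hC.le) (by norm_num)) hIu0)
        (mul_le_mul_of_nonneg_right (mul_le_mul_of_nonneg_left
          (mul_le_mul_of_nonneg_left h2 hC.le) (by norm_num)) hIf0)
    · intro a ha
      -- On the core the thin set is only known to have measure at most 1 in each unit interval; the
      -- smallness comes from 1/ℓ.
      have hP0 : 0 ≤ 9 / ℓ * Nu + 8 * ℓ / lam * Nf := by positivity
      refine (intervalIntegral_indicator_le hS (fun x => sq_nonneg _) (K := 9 / ℓ * Nu +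
        8 * ℓ / lam * Nf) fun x hx => ?_).trans (mul_le_of_le_one_right hP0 ?_)
      · have hx2 : |x| ≤ ℓ / 2 := by
          have := abs_lt.1 ha
          rw [abs_le]
          constructor <;> linarith only [hx.1, hx.2, this.1, this.2, hℓ, hR1]
        refine (hsol.norm_sq_le_long_window hℓ1 hlam2 hx2).trans ?_
        have h1 := intervalIntegral_le_integral hu (fun x => sq_nonneg _)
          (by linarith : -(3 / 2 * ℓ) ≤ 3 / 2 * ℓ)
        have h2 := intervalIntegral_le_integral hf (fun x => sq_nonneg _)
          (by linarith : -(3 / 2 * ℓ) ≤ 3 / 2 * ℓ)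
        gcongr
      · refine (measureReal_mono Set.inter_subset_right measure_Icc_lt_top.ne).trans ?_
        rw [Real.volume_real_Icc_of_le (by linarith)]
        linarith
  have h1 : 2 * R * (9 / ℓ * Nu) ≤ 1 / 8 * Nu := by
    rw [← mul_assoc]
    refine mul_le_mul_of_nonneg_right ?_ hNu0
    rw [mul_div_assoc', div_le_iff₀ (by linarith)]
    linarith
  have h2 : 3 * (60 * (C * (R : ℝ) ^ (-α))) * Nu ≤ 1 / 8 * Nu :=
    mul_le_mul_of_nonneg_right (by linarith) hNu0
  have h3 : (24 * C * Q + 16 * R * ℓ / lam) * Nf ≤ 1 / 4 * Nu := by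
    rw [windowWidth_eq_mul, mul_pow] at hfu
    set W := windowWidth α 1 lam ^ 2 with hW
    have e3 : (24 * C * Q + 16 * R * ℓ / lam) * W ≤ M :=
      mul_windowWidth_one_sq_le hlam1 (by positivity) (by positivity)
    have e4 := sq_mul_le_of_le_one_div hε hM1 hεM
    have e5 : 0 ≤ 24 * C * Q + 16 * R * ℓ / lam := by positivity
    calc (24 * C * Q + 16 * R * ℓ / lam) * Nf
        ≤ (24 * C * Q + 16 * R * ℓ / lam) * (ε ^ 2 * W * Nu) :=
          mul_le_mul_of_nonneg_left hfu e5
      _ = ε ^ 2 * ((24 * C * Q + 16 * R * ℓ / lam) * W) * Nu := by ring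
      _ ≤ ε ^ 2 * M * Nu := by gcongr
      _ ≤ 1 / 4 * Nu := mul_le_mul_of_nonneg_right e4 hNu0
  have h4 : (24 * C * Q + 16 * R * ℓ / lam) * Nf =
      3 * (8 * (C * Q)) * Nf + 2 * R * (8 * ℓ / lam * Nf) := by ring
  rw [h4] at h3
  linarith only [key, h1, h2, h3]

/-- The spectral inequality at the frequency `λ_n`, with both constants equal to `t`. -/
def SpectralInequality (α t : ℝ) (E : Set ℝ) (n : ℕ+) : Prop :=
  ∀ φ : ℕ+ → ℝ → ℂ, IsEigenfunctionSystem φ → ∀ c : ℕ+ → ℂ,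
    t * ∑ k ∈ (finite_J α t (eigenvalue n)).toFinset, ‖c k‖ ^ 2 ≤
      ∫ x in E, ‖∑ k ∈ (finite_J α t (eigenvalue n)).toFinset, c k * φ k x‖ ^ 2

theorem eventually_spectralInequality {α : ℝ} {E : Set ℝ} (hE : volume E ≠ 0) (n : ℕ+) :
    ∀ᶠ t in nhdsWithin (0 : ℝ) (Set.Ioi 0), SpectralInequality α t E n := by
  have hw : Tendsto (fun t => windowWidth α t (eigenvalue n)) (nhdsWithin (0 : ℝ) (Set.Ioi 0))
      (nhds 0) := by
    rw [funext fun t => windowWidth_eq_mul α t (eigenvalue n)]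
    have : Tendsto (fun t : ℝ => t * windowWidth α 1 (eigenvalue n)) (nhds 0)
        (nhds (0 * windowWidth α 1 (eigenvalue n))) := tendsto_id.mul_const _
    rw [zero_mul] at this
    exact this.mono_left nhdsWithin_le_nhds
  have hF : {k : ℕ+ | k ≠ n ∧ |eigenvalue k - eigenvalue n| < 1}.Finite :=
    (finite_eigenvalue_le (eigenvalue n + 1)).subset fun k hk => by
      have := (abs_lt.1 hk.2).2
      show eigenvalue k ≤ _
      linarith
  -- Only finitely many other eigenvalues lie within distance 1, so a narrow window excludes them
  -- all. The window may also be empty, since positivity of its width is not assumed.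
  have hsep : ∀ᶠ t in nhdsWithin (0 : ℝ) (Set.Ioi 0),
      ∀ k ∈ {k : ℕ+ | k ≠ n ∧ |eigenvalue k - eigenvalue n| < 1},
        windowWidth α t (eigenvalue n) < |eigenvalue k - eigenvalue n| :=
    (eventually_all_finite hF).2 fun k hk =>
      hw.eventually_lt_const (abs_pos.2 (sub_ne_zero.2 (eigenvalue_injective.ne hk.1)))
  obtain ⟨ψ, hψ, hψ1⟩ := (isEigenvalue_eigenvalue n).exists_normalized
  have hpos := hψ.setIntegral_pos (by rintro rfl; simp at hψ1) hE
  have hsmall : ∀ᶠ t in nhdsWithin (0 : ℝ) (Set.Ioi 0), t < ∫ x in E, ‖ψ x‖ ^ 2 :=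
    (tendsto_id.mono_left nhdsWithin_le_nhds).eventually_lt_const hpos
  filter_upwards [hw.eventually_lt_const one_pos, hsep, hsmall] with t h1 h2 h3 φ hφ c
  have hsub : ∀ k ∈ (finite_J α t (eigenvalue n)).toFinset, k = n := fun k hk => by
    rw [Set.Finite.mem_toFinset] at hk
    have hk' : |eigenvalue k - eigenvalue n| < windowWidth α t (eigenvalue n) := hk
    by_contra hne
    exact absurd (h2 k ⟨hne, hk'.trans h1⟩) (not_lt.2 hk'.le)
  by_cases hn : n ∈ (finite_J α t (eigenvalue n)).toFinset
  · rw [Finset.eq_singleton_iff_unique_mem.2 ⟨hn, hsub⟩]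
    simp only [Finset.sum_singleton, norm_mul, mul_pow]
    have hφn := hφ n (isEigenvalue_eigenvalue n)
    simp only [fun x => hφn.isClassicalEigenfunction.norm_eq_norm hψ hφn.norm_eq_one hψ1 x]
    rw [integral_const_mul, mul_comm]
    exact mul_le_mul_of_nonneg_left h3.le (sq_nonneg _)
  · have : (finite_J α t (eigenvalue n)).toFinset = ∅ :=
      Finset.eq_empty_of_forall_notMem fun k hk => hn (hsub k hk ▸ hk)
    rw [this]
    simp

theorem exists_spectralInequality_of_le {α : ℝ} (hα : 1 / 2 ≤ α) {E : Set ℝ}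
    (hE : NullMeasurableSet E volume) (hthin : IsAlphaThin α Eᶜ) :
    ∃ L : ℝ, ∀ᶠ t in nhdsWithin (0 : ℝ) (Set.Ioi 0),
      ∀ n : ℕ+, L ≤ eigenvalue n → SpectralInequality α t E n := by
  obtain ⟨ε₀, hε₀, L, hL⟩ := exists_resolvent_estimate hα hE.compl hthin
  refine ⟨L, ?_⟩
  have hle : ∀ {r : ℝ}, 0 < r → ∀ᶠ t in nhdsWithin (0 : ℝ) (Set.Ioi 0), t < r := fun hr =>
    (tendsto_id.mono_left nhdsWithin_le_nhds).eventually_lt_const hr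
  filter_upwards [self_mem_nhdsWithin, hle hε₀, hle (by norm_num : (0 : ℝ) < 1 / 2)]
    with t ht0 ht1 ht2 n hn φ hφ c
  set T := (finite_J α t (eigenvalue n)).toFinset with hT
  have hφ' : ∀ k ∈ T, IsClassicalEigenfunction (eigenvalue k) (φ k) := fun k _ =>
    (hφ k (isEigenvalue_eigenvalue k)).isClassicalEigenfunction
  have hφ1 : ∀ k ∈ T, ∫ x, ‖φ k x‖ ^ 2 = 1 := fun k _ =>
    (hφ k (isEigenvalue_eigenvalue k)).norm_eq_one
  have hinj : Set.InjOn eigenvalue T := eigenvalue_injective.injOn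
  have hu := integrable_norm_sq_sum T hφ' c
  have hU := integral_norm_sq_sum T hφ' hφ1 hinj c
  have key := hL t (eigenvalue n) ht0 ht1.le hn _ _ _ (isSolution_sum T hφ' c (eigenvalue n)) hu
    (integrable_norm_sq_sum T hφ' _) (by
      rw [hU, integral_norm_sq_sum T hφ' hφ1 hinj, Finset.mul_sum]
      refine Finset.sum_le_sum fun k hk => ?_
      rw [norm_mul, mul_pow, mul_comm, Complex.norm_real, Real.norm_eq_abs]
      have hk' : |eigenvalue k - eigenvalue n| < windowWidth α t (eigenvalue n) :=
        (finite_J α t (eigenvalue n)).mem_toFinset.1 hk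
      exact mul_le_mul_of_nonneg_right (pow_le_pow_left₀ (abs_nonneg _) hk'.le 2) (sq_nonneg _))
  have hsplit := integral_add_compl₀ hE hu
  have h0 : 0 ≤ ∑ k ∈ T, ‖c k‖ ^ 2 := Finset.sum_nonneg fun _ _ => sq_nonneg _
  rw [hU] at key hsplit
  -- The mass on E is at least half of the total, and t < 1/2.
  nlinarith

end AnharmonicOscillator

theorem proposition3p1 (α : ℝ) (hα : 1 / 2 ≤ α) (E : Set ℝ) (hE : NullMeasurableSet E volume)
    (hthin : AnharmonicOscillator.IsAlphaThin α Eᶜ) :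
    ∃ ε : ℝ, 0 < ε ∧ ∃ δ : ℝ, 0 < δ ∧
      ∀ φ : ℕ+ → ℝ → ℂ, AnharmonicOscillator.IsEigenfunctionSystem φ →
        ∀ n : ℕ+,
          ∃ hJ : (AnharmonicOscillator.J α ε (AnharmonicOscillator.eigenvalue n)).Finite,
            ∀ c : lp (fun _ : ℕ+ => ℂ) 2,
              δ * ∑ k ∈ hJ.toFinset, ‖c k‖ ^ 2 ≤
                ∫ x in E, ‖∑ k ∈ hJ.toFinset, c k * φ k x‖ ^ 2 := by
  obtain ⟨L, hL⟩ := AnharmonicOscillator.exists_spectralInequality_of_le hα hE hthin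
  have hlow : ∀ᶠ t in nhdsWithin (0 : ℝ) (Set.Ioi 0),
      ∀ n ∈ {n : ℕ+ | AnharmonicOscillator.eigenvalue n ≤ L},
        AnharmonicOscillator.SpectralInequality α t E n :=
    (eventually_all_finite (AnharmonicOscillator.finite_eigenvalue_le L)).2 fun n _ =>
      AnharmonicOscillator.eventually_spectralInequality
        (hthin.volume_compl_ne_zero (by linarith)) n
  -- Both regimes hold for all small t > 0, so one t serves as ε and as δ for every n.
  obtain ⟨t, ht0, h1, h2⟩ := (eventually_mem_nhdsWithin.and (hL.and hlow)).exists
  refine ⟨t, ht0, t, ht0, fun φ hφ n => ⟨AnharmonicOscillator.finite_J _ _ _, fun c => ?_⟩⟩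
  rcases le_total L (AnharmonicOscillator.eigenvalue n) with h | h
  · exact h1 n h φ hφ c
  · exact h2 n h φ hφ c
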